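/- Let $c,m>0$, let $\Omega_+\subset\mathbb R^3$ be a bounded domain with $C^2$-smooth boundary $\Sigma=\partial\Omega_+$, let $\Omega_-=\mathbb R^3\setminus\overline{\Omega_+}$, and let $\nu$ be the unit normal field on $\Sigma$ pointing out of $\Omega_+$. Let $\sigma_1,\sigma_2,\sigma_3$ be the Pauli matrices and $$\alpha_j=\begin{pmatrix}0&\sigma_j\\ \sigma_j&0\end{pmatrix},\qquad \beta=\begin{pmatrix}I_2&0\\0&-I_2\end{pmatrix},\qquad \alpha\cdot x=\sum_{j=1}^3\alpha_jx_j,\qquad \alpha\cdot\nabla=\sum_{j=1}^3\alpha_j\partial_j .$$ For $\eta,\tau\in\mathbb R$ let $A_{\eta,\tau}$ be the operator in $L^2(\mathbb R^3)^4=L^2(\Omega_+)^4\oplus L^2(\Omega_-)^4$ whose domain consists of all $f=f_+\oplus f_-\in H^1(\Omega_+)^4\oplus H^1(\Omega_-)^4$ whose traces on $\Sigma$ satisfy $$ic\,(\alpha\cdot\nu)\,(f_+|_\Sigma-f_-|_\Sigma)+\tfrac12(\eta I_4+\tau\beta)(f_+|_\Sigma+f_-|_\Sigma)=0\quad\text{a.e.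 on }\Sigma,$$ and which acts as $$A_{\eta,\tau}f=(-ic\,\alpha\cdot\nabla+mc^2\beta)f_+\oplus(-ic\,\alpha\cdot\nabla+mc^2\beta)f_- .$$ Let $\sigma_{\mathrm p}(A)$ denote the set of all (complex) eigenvalues of $A$; the multiplicity of $\lambda\in\sigma_{\mathrm p}(A)$ is $\dim_{\mathbb C}\ker(A-\lambda)$. **Proposition.** Let $\eta,\tau\in\mathbb R$ with $\eta^2-\tau^2\neq4c^2$. Then: (i) If $\eta^2\neq\tau^2$, then $\lambda\in\sigma_{\mathrm p}\big(A_{-4c^2\eta/(\eta^2-\tau^2),\,-4c^2\tau/(\eta^2-\tau^2)}\big)$ if and only if $\lambda\in\sigma_{\mathrm p}(A_{\eta,\tau})$. (ii) Every $\lambda\in\sigma_{\mathrm p}(A_{\eta,\tau})$ has even multiplicity (an infinite multiplicity, which is not excluded here, counts as even). (iii) $\lambda\in\sigma_{\mathrm p}(A_{\eta,\tau})$ if and only if $-\lambda\in\sigma_{\mathrm p}(A_{-\eta,\tau})$. -/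

import Mathlib

open MeasureTheory Filter Topology
open scoped ContDiff

namespace DiracShell

/-- Physical space `ℝ³` with its Euclidean structure. -/
abbrev Space : Type := EuclideanSpace ℝ (Fin 3)

/-- The spinor space `ℂ⁴` with its Euclidean structure. -/
abbrev Spinor : Type := EuclideanSpace ℂ (Fin 4)

/-- The Hilbert space `L²(ℝ³)⁴ = L²(ℝ³; ℂ⁴)`. -/
abbrev HilbertL2 : Type := Lp Spinor 2 (volume : Measure Space)

/-! ### Dirac matrices -/

/-- The Pauli matrices `σ₁, σ₂, σ₃` (indexed by `0, 1, 2`). -/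
def pauli : Fin 3 → Matrix (Fin 2) (Fin 2) ℂ :=
  ![!![0, 1; 1, 0], !![0, -Complex.I; Complex.I, 0], !![1, 0; 0, -1]]

/-- The identification of `ℂ² ⊕ ℂ²` with `ℂ⁴` that is used for block matrices. -/
def blockEquiv : Fin 2 ⊕ Fin 2 ≃ Fin 4 := finSumFinEquiv

/-- The Dirac matrices `αⱼ = (0 σⱼ; σⱼ 0)`. -/
def diracAlpha (j : Fin 3) : Matrix (Fin 4) (Fin 4) ℂ :=
  Matrix.reindex blockEquiv blockEquiv (Matrix.fromBlocks 0 (pauli j) (pauli j) 0)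

/-- The Dirac matrix `β = (I₂ 0; 0 -I₂)`. -/
def diracBeta : Matrix (Fin 4) (Fin 4) ℂ :=
  Matrix.reindex blockEquiv blockEquiv
    (Matrix.fromBlocks (1 : Matrix (Fin 2) (Fin 2) ℂ) 0 0 (-1))

/-- `α · x = ∑ⱼ xⱼ αⱼ`. -/
noncomputable def alphaDot (x : Space) : Matrix (Fin 4) (Fin 4) ℂ :=
  ∑ j, ((x j : ℝ) : ℂ) • diracAlpha j

/-- A `4 × 4` matrix acting on spinors. -/
noncomputable def act (M : Matrix (Fin 4) (Fin 4) ℂ) : Spinor →L[ℂ] Spinor :=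
  Matrix.toEuclideanCLM (n := Fin 4) (𝕜 := ℂ) M

/-! ### Domains with `C²` boundary, outward normal and surface measure -/

/-- `ρ` is a `C²` local defining function of `Ω` at `x`: near `x` the set `Ω` is `{ρ < 0}`, and
`∇ρ(x) ≠ 0`. -/
def IsLocalDefiningFunction (Ω : Set Space) (x : Space) (ρ : Space → ℝ) : Prop :=
  ContDiffAt ℝ 2 ρ x ∧ gradient ρ x ≠ 0 ∧ ∀ᶠ y in 𝓝 x, (y ∈ Ω ↔ ρ y < 0)

/-- A bounded domain (nonempty, connected, open set) in `ℝ³` with `C²` boundary: near every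
boundary point it is the sublevel set `{ρ < 0}` of a `C²` function with nonzero gradient. -/
structure BoundedC2Domain where
  /-- The underlying set. -/
  carrier : Set Space
  isOpen : IsOpen carrier
  isConnected : IsConnected carrier
  isBounded : Bornology.IsBounded carrier
  boundary_c2 : ∀ x ∈ frontier carrier, ∃ ρ, IsLocalDefiningFunction carrier x ρ

/-- `n` is an outward unit normal vector of `Ω` at the boundary point `x`:
`n = ∇ρ(x) / |∇ρ(x)|` for a local defining function `ρ`. -/
def IsOutwardUnitNormal (Ω : Set Space) (x n : Space) : Prop :=
  ∃ ρ, IsLocalDefiningFunction Ω x ρ ∧ n = ‖gradient ρ x‖⁻¹ • gradient ρ x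

open Classical in
/-- The outward unit normal `ν(x)` of `Ω` at a `C²` boundary point `x` (junk value `0` at points
that have no local defining function). -/
noncomputable def outwardNormal (Ω : Set Space) (x : Space) : Space :=
  if h : ∃ n, IsOutwardUnitNormal Ω x n then h.choose else 0

/-- The surface measure `σ` on `Σ = ∂Ω`: two-dimensional Hausdorff measure. -/
noncomputable def surfaceMeasure (Ω : Set Space) : Measure Space :=
  (Measure.euclideanHausdorffMeasure 2 : Measure Space).restrict (frontier Ω)

/-! ### The Sobolev space `H¹(Ω)⁴` and the trace on the boundary -/

/-- The classical partial derivative `∂ⱼ φ`. -/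
noncomputable def classicalPartial {F : Type} [NormedAddCommGroup F] [NormedSpace ℝ F]
    (j : Fin 3) (φ : Space → F) (x : Space) : F :=
  fderiv ℝ φ x (EuclideanSpace.single j 1)

/-- `g` is the distributional partial derivative `∂ⱼ f` in the open set `Ω`. -/
def HasWeakPartial (Ω : Set Space) (j : Fin 3) (f g : Space → Spinor) : Prop :=
  ∀ φ : Space → ℝ, ContDiff ℝ ∞ φ → HasCompactSupport φ → tsupport φ ⊆ Ω →
    ∫ x in Ω, classicalPartial j φ x • f x = - ∫ x in Ω, φ x • g x

/-- `f` has a distributional partial derivative `∂ⱼ f` in `L²(Ω)⁴`. -/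
def HasL2Partial (Ω : Set Space) (j : Fin 3) (f : Space → Spinor) : Prop :=
  ∃ g : Space → Spinor, MemLp g 2 (volume.restrict Ω) ∧ HasWeakPartial Ω j f g

/-- `f ↾ Ω ∈ H¹(Ω)⁴`. -/
def MemH1 (Ω : Set Space) (f : Space → Spinor) : Prop :=
  MemLp f 2 (volume.restrict Ω) ∧ ∀ j, HasL2Partial Ω j f

open Classical in
/-- The distributional partial derivative `∂ⱼ f ∈ L²(Ω)⁴`, unique almost everywhere in `Ω`
(junk value `0` if there is none). -/
noncomputable def weakPartial (Ω : Set Space) (j : Fin 3) (f : Space → Spinor) :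
    Space → Spinor :=
  if h : HasL2Partial Ω j f then h.choose else 0

/-- `g` is the boundary trace on `S` of `f ∈ H¹(Ω)⁴`. The trace operator is the continuous
extension to `H¹(Ω)⁴` of the restriction map `φ ↦ φ|_S`, defined on the dense set of (restrictions
to `Ω` of) test functions, into `L²(S, μ)⁴`; so `g` is the trace of `f` if some sequence of test
functions converges to `f` in `H¹(Ω)⁴` and to `g` in `L²(S, μ)⁴`. Here `μ` is a measure
concentrated on `S`. -/
def IsTrace (Ω : Set Space) (μ : Measure Space) (f g : Space → Spinor) : Prop :=
  MemLp g 2 μ ∧ ∃ φ : ℕ → Space → Spinor,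
    (∀ n, ContDiff ℝ ∞ (φ n) ∧ HasCompactSupport (φ n)) ∧
    Tendsto (fun n => eLpNorm (φ n - f) 2 (volume.restrict Ω)) atTop (𝓝 0) ∧
    (∀ j, Tendsto (fun n => eLpNorm (classicalPartial j (φ n) - weakPartial Ω j f) 2
      (volume.restrict Ω)) atTop (𝓝 0)) ∧
    Tendsto (fun n => eLpNorm (φ n - g) 2 μ) atTop (𝓝 0)

/-! ### The Dirac operator with a `δ`-shell interaction -/

/-- The exterior domain `Ω₋ = ℝ³ \ closure Ω₊`. -/
def exterior (Ω : Set Space) : Set Space := (closure Ω)ᶜ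

/-- The differential expression `(-i c α · ∇ + m c² β) f` in `Ω`. -/
noncomputable def diracExpr (c m : ℝ) (Ω : Set Space) (f : Space → Spinor) : Space → Spinor :=
  fun x => (-Complex.I * (c : ℂ)) • ∑ j, act (diracAlpha j) (weakPartial Ω j f x)
    + ((m * c ^ 2 : ℝ) : ℂ) • act diracBeta (f x)

/-- The coupling condition
`i c (α · ν) (f₊|_Σ - f₋|_Σ) + ½ (η I₄ + τ β) (f₊|_Σ + f₋|_Σ) = 0`, almost everywhere on `Σ`. -/
def CouplingCondition (c η τ : ℝ) (Ω : Set Space) (gp gm : Space → Spinor) : Prop :=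
  ∀ᵐ x ∂(surfaceMeasure Ω),
    (Complex.I * (c : ℂ)) • act (alphaDot (outwardNormal Ω x)) (gp x - gm x)
      + (1 / 2 : ℂ) • act ((η : ℂ) • (1 : Matrix (Fin 4) (Fin 4) ℂ) + (τ : ℂ) • diracBeta)
          (gp x + gm x) = 0

/-- `f = f₊ ⊕ f₋` belongs to `H¹(Ω₊)⁴ ⊕ H¹(Ω₋)⁴` and its traces on `Σ` satisfy the coupling
condition. -/
def MemDomain (c η τ : ℝ) (Ω : Set Space) (f : Space → Spinor) : Prop :=
  MemH1 Ω f ∧ MemH1 (exterior Ω) f ∧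
    ∃ gp gm : Space → Spinor, IsTrace Ω (surfaceMeasure Ω) f gp ∧
      IsTrace (exterior Ω) (surfaceMeasure Ω) f gm ∧ CouplingCondition c η τ Ω gp gm

open Classical in
/-- The function equal to `(-i c α · ∇ + m c² β) f₊` in `Ω₊` and to `(-i c α · ∇ + m c² β) f₋`
in `Ω₋` (and to `0` on the null set `Σ`). -/
noncomputable def shellExpr (c m : ℝ) (Ω : Set Space) (f : Space → Spinor) : Space → Spinor :=
  Ω.indicator (diracExpr c m Ω f) + (exterior Ω).indicator (diracExpr c m (exterior Ω) f)


/-! #### Well-definedness and linearity -/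

lemma HasWeakPartial.ae_eq {Ω : Set Space} (hΩ : IsOpen Ω) {j : Fin 3} {f g g' : Space → Spinor}
    (hg : MemLp g 2 (volume.restrict Ω)) (hg' : MemLp g' 2 (volume.restrict Ω))
    (h : HasWeakPartial Ω j f g) (h' : HasWeakPartial Ω j f g') :
    g =ᵐ[volume.restrict Ω] g' := by
  have hl : ∀ {k : Space → Spinor}, MemLp k 2 (volume.restrict Ω) →
      LocallyIntegrableOn k Ω volume := fun hk =>
    locallyIntegrableOn_of_locallyIntegrable_restrict (hk.locallyIntegrable (by norm_num))
  have key := hΩ.ae_eq_zero_of_integral_contDiff_smul_eq_zero (f := g - g') (μ := volume)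
    ((hl hg).sub (hl hg')) ?_
  · rw [Filter.EventuallyEq, ae_restrict_iff' hΩ.measurableSet]
    filter_upwards [key] with x hx hxΩ
    exact sub_eq_zero.mp (hx hxΩ)
  · intro φ hφ hc hs
    have hint : ∀ {k : Space → Spinor}, MemLp k 2 (volume.restrict Ω) →
        Integrable (fun x => φ x • k x) (volume.restrict Ω) := fun hk =>
      (hk.locallyIntegrable (by norm_num)).integrable_smul_left_of_hasCompactSupport
        hφ.continuous hc
    have e : ∫ x, φ x • (g - g') x = ∫ x in Ω, φ x • (g - g') x := by
      rw [setIntegral_eq_integral_of_forall_compl_eq_zero]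
      intro x hx
      rw [image_eq_zero_of_notMem_tsupport (fun hh => hx (hs hh)), zero_smul]
    rw [e]
    have e2 : ∀ x, φ x • (g - g') x = φ x • g x - φ x • g' x := fun x => by
      simp [smul_sub]
    simp_rw [e2]
    rw [integral_sub (hint hg) (hint hg')]
    have := (h φ hφ hc hs).symm.trans (h' φ hφ hc hs)
    rw [neg_inj.mp this, sub_self]

lemma HasL2Partial.memLp_weakPartial {Ω : Set Space} {j : Fin 3} {f : Space → Spinor}
    (h : HasL2Partial Ω j f) : MemLp (weakPartial Ω j f) 2 (volume.restrict Ω) := by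
  rw [weakPartial, dif_pos h]; exact h.choose_spec.1

lemma HasL2Partial.hasWeakPartial {Ω : Set Space} {j : Fin 3} {f : Space → Spinor}
    (h : HasL2Partial Ω j f) : HasWeakPartial Ω j f (weakPartial Ω j f) := by
  rw [weakPartial, dif_pos h]; exact h.choose_spec.2

lemma integrable_test_smul {Ω : Set Space} {φ : Space → ℝ} {k : Space → Spinor}
    (hφ : Continuous φ) (hc : HasCompactSupport φ) (hk : MemLp k 2 (volume.restrict Ω)) :
    Integrable (fun x => φ x • k x) (volume.restrict Ω) :=
  (hk.locallyIntegrable (by norm_num)).integrable_smul_left_of_hasCompactSupport hφ hc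

lemma integrable_partial_smul {Ω : Set Space} {φ : Space → ℝ} {k : Space → Spinor} (j : Fin 3)
    (hφ : ContDiff ℝ ∞ φ) (hc : HasCompactSupport φ) (hk : MemLp k 2 (volume.restrict Ω)) :
    Integrable (fun x => classicalPartial j φ x • k x) (volume.restrict Ω) :=
  integrable_test_smul ((hφ.continuous_fderiv (by simp)).clm_apply continuous_const)
    (hc.fderiv_apply (𝕜 := ℝ) _) hk

lemma HasWeakPartial.add {Ω : Set Space} {j : Fin 3} {f f' g g' k : Space → Spinor}
    (hf : MemLp f 2 (volume.restrict Ω)) (hf' : MemLp f' 2 (volume.restrict Ω))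
    (hg : MemLp g 2 (volume.restrict Ω)) (hg' : MemLp g' 2 (volume.restrict Ω))
    (h : HasWeakPartial Ω j f g) (h' : HasWeakPartial Ω j f' g')
    (hk : k =ᵐ[volume.restrict Ω] f + f') : HasWeakPartial Ω j k (g + g') := by
  intro φ hφ hc hs
  have e1 : ∫ x in Ω, classicalPartial j φ x • k x
      = ∫ x in Ω, (classicalPartial j φ x • f x + classicalPartial j φ x • f' x) := by
    refine integral_congr_ae ?_
    filter_upwards [hk] with x hx
    rw [hx, Pi.add_apply, smul_add]
  have e2 : ∀ x, φ x • (g + g') x = φ x • g x + φ x • g' x := fun x => by simp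
  simp_rw [e1, e2]
  rw [integral_add (integrable_partial_smul j hφ hc hf) (integrable_partial_smul j hφ hc hf'),
    integral_add (integrable_test_smul hφ.continuous hc hg)
      (integrable_test_smul hφ.continuous hc hg'), h φ hφ hc hs, h' φ hφ hc hs, neg_add]

lemma HasWeakPartial.smul {Ω : Set Space} {j : Fin 3} {f g k : Space → Spinor} (a : ℂ)
    (h : HasWeakPartial Ω j f g) (hk : k =ᵐ[volume.restrict Ω] a • f) :
    HasWeakPartial Ω j k (a • g) := by
  intro φ hφ hc hs
  have e1 : ∫ x in Ω, classicalPartial j φ x • k x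
      = ∫ x in Ω, a • (classicalPartial j φ x • f x) := by
    refine integral_congr_ae ?_
    filter_upwards [hk] with x hx
    rw [hx, Pi.smul_apply, smul_comm]
  have e2 : ∀ x, φ x • (a • g) x = a • (φ x • g x) := fun x => by
    rw [Pi.smul_apply, smul_comm]
  simp_rw [e1, e2]
  rw [integral_smul, integral_smul, h φ hφ hc hs, smul_neg]

lemma MemH1.add {Ω : Set Space} {f f' k : Space → Spinor} (h : MemH1 Ω f) (h' : MemH1 Ω f')
    (hk : k =ᵐ[volume.restrict Ω] f + f') : MemH1 Ω k :=
  ⟨(memLp_congr_ae hk).mpr (h.1.add h'.1), fun j =>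
    ⟨_, (h.2 j).memLp_weakPartial.add (h'.2 j).memLp_weakPartial,
      (h.2 j).hasWeakPartial.add h.1 h'.1 (h.2 j).memLp_weakPartial (h'.2 j).memLp_weakPartial
        (h'.2 j).hasWeakPartial hk⟩⟩

lemma MemH1.smul {Ω : Set Space} {f k : Space → Spinor} (a : ℂ) (h : MemH1 Ω f)
    (hk : k =ᵐ[volume.restrict Ω] a • f) : MemH1 Ω k :=
  ⟨(memLp_congr_ae hk).mpr (h.1.const_smul a), fun j =>
    ⟨_, (h.2 j).memLp_weakPartial.const_smul a, (h.2 j).hasWeakPartial.smul a hk⟩⟩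

lemma weakPartial_add {Ω : Set Space} (hΩ : IsOpen Ω) {f f' k : Space → Spinor}
    (h : MemH1 Ω f) (h' : MemH1 Ω f') (hk : k =ᵐ[volume.restrict Ω] f + f') (j : Fin 3) :
    weakPartial Ω j k =ᵐ[volume.restrict Ω] weakPartial Ω j f + weakPartial Ω j f' :=
  HasWeakPartial.ae_eq hΩ ((h.add h' hk).2 j).memLp_weakPartial
    ((h.2 j).memLp_weakPartial.add (h'.2 j).memLp_weakPartial)
    ((h.add h' hk).2 j).hasWeakPartial
    ((h.2 j).hasWeakPartial.add h.1 h'.1 (h.2 j).memLp_weakPartial (h'.2 j).memLp_weakPartial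
        (h'.2 j).hasWeakPartial hk)

lemma weakPartial_smul {Ω : Set Space} (hΩ : IsOpen Ω) {f k : Space → Spinor} (a : ℂ)
    (h : MemH1 Ω f) (hk : k =ᵐ[volume.restrict Ω] a • f) (j : Fin 3) :
    weakPartial Ω j k =ᵐ[volume.restrict Ω] a • weakPartial Ω j f :=
  HasWeakPartial.ae_eq hΩ ((h.smul a hk).2 j).memLp_weakPartial
    ((h.2 j).memLp_weakPartial.const_smul a)
    ((h.smul a hk).2 j).hasWeakPartial ((h.2 j).hasWeakPartial.smul a hk)

lemma tendsto_eLpNorm_add {μ : Measure Space} {φ ψ : ℕ → Space → Spinor}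
    {f g k : Space → Spinor} (hφ : ∀ n, AEStronglyMeasurable (φ n) μ)
    (hψ : ∀ n, AEStronglyMeasurable (ψ n) μ)
    (hf : AEStronglyMeasurable f μ) (hg : AEStronglyMeasurable g μ)
    (h : Tendsto (fun n => eLpNorm (φ n - f) 2 μ) atTop (𝓝 0))
    (h' : Tendsto (fun n => eLpNorm (ψ n - g) 2 μ) atTop (𝓝 0))
    (hk : k =ᵐ[μ] f + g) :
    Tendsto (fun n => eLpNorm (φ n + ψ n - k) 2 μ) atTop (𝓝 0) := by
  have hs := h.add h'
  rw [add_zero] at hs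
  refine tendsto_of_tendsto_of_tendsto_of_le_of_le tendsto_const_nhds hs (fun _ => zero_le) ?_
  intro n
  have e : φ n + ψ n - k =ᵐ[μ] (φ n - f) + (ψ n - g) := by
    filter_upwards [hk] with x hx
    simp only [Pi.add_apply, Pi.sub_apply] at hx ⊢
    rw [hx]; abel
  show eLpNorm (φ n + ψ n - k) 2 μ ≤ eLpNorm (φ n - f) 2 μ + eLpNorm (ψ n - g) 2 μ
  rw [eLpNorm_congr_ae e]
  exact eLpNorm_add_le ((hφ n).sub hf) ((hψ n).sub hg) (by norm_num)

lemma tendsto_eLpNorm_smul {μ : Measure Space} {φ : ℕ → Space → Spinor}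
    {f k : Space → Spinor} (a : ℂ)
    (h : Tendsto (fun n => eLpNorm (φ n - f) 2 μ) atTop (𝓝 0)) (hk : k =ᵐ[μ] a • f) :
    Tendsto (fun n => eLpNorm (a • φ n - k) 2 μ) atTop (𝓝 0) := by
  have hs := ENNReal.Tendsto.const_mul (a := ‖a‖ₑ) h (Or.inr enorm_ne_top)
  rw [mul_zero] at hs
  refine hs.congr fun n => ?_
  have e : a • φ n - k =ᵐ[μ] a • (φ n - f) := by
    filter_upwards [hk] with x hx
    simp only [Pi.smul_apply, Pi.sub_apply] at hx ⊢
    rw [hx, smul_sub]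
  rw [eLpNorm_congr_ae e, eLpNorm_const_smul]

lemma classicalPartial_add {φ ψ : Space → Spinor} (j : Fin 3) (hφ : ContDiff ℝ ∞ φ)
    (hψ : ContDiff ℝ ∞ ψ) :
    classicalPartial j (φ + ψ) = classicalPartial j φ + classicalPartial j ψ := by
  funext x
  simp only [classicalPartial, Pi.add_apply]
  rw [fderiv_add (hφ.differentiable (by simp) x) (hψ.differentiable (by simp) x)]
  rfl

lemma classicalPartial_smul {φ : Space → Spinor} (j : Fin 3) (a : ℂ) (hφ : ContDiff ℝ ∞ φ) :
    classicalPartial j (a • φ) = a • classicalPartial j φ := by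
  funext x
  simp only [classicalPartial, Pi.smul_apply]
  rw [fderiv_const_smul (hφ.differentiable (by simp) x)]
  rfl

lemma continuous_classicalPartial {φ : Space → Spinor} (j : Fin 3) (hφ : ContDiff ℝ ∞ φ) :
    Continuous (classicalPartial j φ) :=
  (hφ.continuous_fderiv (by simp)).clm_apply continuous_const

lemma IsTrace.add {Ω : Set Space} (hΩ : IsOpen Ω) {μ : Measure Space}
    {f f' k g g' : Space → Spinor} (hf : MemH1 Ω f) (hf' : MemH1 Ω f')
    (hk : k =ᵐ[volume.restrict Ω] f + f') (h : IsTrace Ω μ f g) (h' : IsTrace Ω μ f' g') :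
    IsTrace Ω μ k (g + g') := by
  obtain ⟨hg, φ, h1, h2, h3, h4⟩ := h
  obtain ⟨hg', ψ, h1', h2', h3', h4'⟩ := h'
  refine ⟨hg.add hg', fun n => φ n + ψ n,
    fun n => ⟨(h1 n).1.add (h1' n).1, (h1 n).2.add (h1' n).2⟩, ?_, fun j => ?_, ?_⟩
  · exact tendsto_eLpNorm_add (fun n => (h1 n).1.continuous.aestronglyMeasurable)
      (fun n => (h1' n).1.continuous.aestronglyMeasurable) hf.1.1 hf'.1.1 h2 h2' hk
  · simp_rw [classicalPartial_add j (h1 _).1 (h1' _).1]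
    exact tendsto_eLpNorm_add
      (fun n => (continuous_classicalPartial j (h1 n).1).aestronglyMeasurable)
      (fun n => (continuous_classicalPartial j (h1' n).1).aestronglyMeasurable)
      (hf.2 j).memLp_weakPartial.1 (hf'.2 j).memLp_weakPartial.1 (h3 j) (h3' j)
      (weakPartial_add hΩ hf hf' hk j)
  · exact tendsto_eLpNorm_add (fun n => (h1 n).1.continuous.aestronglyMeasurable)
      (fun n => (h1' n).1.continuous.aestronglyMeasurable) hg.1 hg'.1 h4 h4' (ae_eq_refl _)

lemma IsTrace.smul {Ω : Set Space} (hΩ : IsOpen Ω) {μ : Measure Space}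
    {f k g : Space → Spinor} (a : ℂ) (hf : MemH1 Ω f)
    (hk : k =ᵐ[volume.restrict Ω] a • f) (h : IsTrace Ω μ f g) :
    IsTrace Ω μ k (a • g) := by
  obtain ⟨hg, φ, h1, h2, h3, h4⟩ := h
  refine ⟨hg.const_smul a, fun n => a • φ n,
    fun n => ⟨contDiff_const.smul (h1 n).1, (h1 n).2.mono fun x hx hx0 => hx ?_⟩, ?_,
    fun j => ?_, ?_⟩
  · simp [hx0]
  · exact tendsto_eLpNorm_smul a h2 hk
  · simp_rw [classicalPartial_smul j a (h1 _).1]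
    exact tendsto_eLpNorm_smul a (h3 j) (weakPartial_smul hΩ a hf hk j)
  · exact tendsto_eLpNorm_smul a h4 (ae_eq_refl _)

lemma hasWeakPartial_zero {Ω : Set Space} (j : Fin 3) {k : Space → Spinor}
    (hk : k =ᵐ[volume.restrict Ω] 0) : HasWeakPartial Ω j k 0 := by
  intro φ _ _ _
  have e1 : ∫ x in Ω, classicalPartial j φ x • k x = ∫ x in Ω, (0 : Spinor) := by
    refine integral_congr_ae ?_
    filter_upwards [hk] with x hx
    rw [hx, Pi.zero_apply, smul_zero]
  rw [e1]
  simp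

lemma memH1_zero {Ω : Set Space} {k : Space → Spinor} (hk : k =ᵐ[volume.restrict Ω] 0) :
    MemH1 Ω k :=
  ⟨(memLp_congr_ae hk).mpr MemLp.zero, fun j => ⟨0, MemLp.zero, hasWeakPartial_zero j hk⟩⟩

lemma isTrace_zero {Ω : Set Space} (hΩ : IsOpen Ω) {μ : Measure Space} {k : Space → Spinor}
    (hk : k =ᵐ[volume.restrict Ω] 0) : IsTrace Ω μ k 0 := by
  refine ⟨MemLp.zero, fun _ => 0, fun _ => ⟨contDiff_const, HasCompactSupport.zero⟩, ?_,
    fun j => ?_, ?_⟩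
  · have e : (0 : Space → Spinor) - k =ᵐ[volume.restrict Ω] 0 := by
      filter_upwards [hk] with x hx
      simp [hx]
    simp_rw [eLpNorm_congr_ae e]
    simp
  · have hw : weakPartial Ω j k =ᵐ[volume.restrict Ω] 0 :=
      HasWeakPartial.ae_eq hΩ ((memH1_zero hk).2 j).memLp_weakPartial MemLp.zero
        ((memH1_zero hk).2 j).hasWeakPartial (hasWeakPartial_zero j hk)
    have e : classicalPartial j (0 : Space → Spinor) - weakPartial Ω j k
        =ᵐ[volume.restrict Ω] 0 := by
      filter_upwards [hw] with x hx
      have : classicalPartial j (0 : Space → Spinor) x = 0 := by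
        simp [classicalPartial]
      simp [hx, this]
    simp_rw [eLpNorm_congr_ae e]
    simp
  · simp

lemma MemDomain.add {c η τ : ℝ} {Ω : Set Space} (hΩ : IsOpen Ω) {f f' k : Space → Spinor}
    (h : MemDomain c η τ Ω f) (h' : MemDomain c η τ Ω f') (hk : k =ᵐ[volume] f + f') :
    MemDomain c η τ Ω k := by
  obtain ⟨hp, hm, gp, gm, tp, tm, hc⟩ := h
  obtain ⟨hp', hm', gp', gm', tp', tm', hc'⟩ := h'
  refine ⟨hp.add hp' (ae_restrict_of_ae hk), hm.add hm' (ae_restrict_of_ae hk), gp + gp', gm + gm',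
    tp.add hΩ hp hp' (ae_restrict_of_ae hk) tp',
    tm.add isClosed_closure.isOpen_compl hm hm' (ae_restrict_of_ae hk) tm', ?_⟩
  filter_upwards [hc, hc'] with x hx hx'
  have e1 : (gp + gp') x - (gm + gm') x = (gp x - gm x) + (gp' x - gm' x) := by
    simp only [Pi.add_apply]; abel
  have e2 : (gp + gp') x + (gm + gm') x = (gp x + gm x) + (gp' x + gm' x) := by
    simp only [Pi.add_apply]; abel
  rw [e1, e2, map_add, map_add, smul_add, smul_add, add_add_add_comm, hx, hx', add_zero]

lemma MemDomain.smul {c η τ : ℝ} {Ω : Set Space} (hΩ : IsOpen Ω) {f k : Space → Spinor} (a : ℂ)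
    (h : MemDomain c η τ Ω f) (hk : k =ᵐ[volume] a • f) : MemDomain c η τ Ω k := by
  obtain ⟨hp, hm, gp, gm, tp, tm, hc⟩ := h
  refine ⟨hp.smul a (ae_restrict_of_ae hk), hm.smul a (ae_restrict_of_ae hk), a • gp, a • gm,
    tp.smul hΩ a hp (ae_restrict_of_ae hk),
    tm.smul isClosed_closure.isOpen_compl a hm (ae_restrict_of_ae hk), ?_⟩
  filter_upwards [hc] with x hx
  have e1 : (a • gp) x - (a • gm) x = a • (gp x - gm x) := by
    simp only [Pi.smul_apply, smul_sub]
  have e2 : (a • gp) x + (a • gm) x = a • (gp x + gm x) := by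
    simp only [Pi.smul_apply, smul_add]
  rw [e1, e2, map_smul, map_smul, smul_comm _ a, smul_comm _ a, ← smul_add, hx, smul_zero]

lemma memDomain_zero {c η τ : ℝ} {Ω : Set Space} (hΩ : IsOpen Ω) {k : Space → Spinor}
    (hk : k =ᵐ[volume] 0) : MemDomain c η τ Ω k :=
  ⟨memH1_zero (ae_restrict_of_ae hk), memH1_zero (ae_restrict_of_ae hk), 0, 0,
    isTrace_zero hΩ (ae_restrict_of_ae hk),
    isTrace_zero isClosed_closure.isOpen_compl (ae_restrict_of_ae hk),
    Filter.Eventually.of_forall fun x => by simp⟩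

lemma memLp_diracExpr {c m : ℝ} {Ω : Set Space} {f : Space → Spinor} (h : MemH1 Ω f) :
    MemLp (diracExpr c m Ω f) 2 (volume.restrict Ω) := by
  have h1 : MemLp (fun x => ∑ j, act (diracAlpha j) (weakPartial Ω j f x)) 2
      (volume.restrict Ω) :=
    memLp_finsetSum Finset.univ fun j _ =>
      (act (diracAlpha j)).comp_memLp' (h.2 j).memLp_weakPartial
  exact (h1.const_smul (-Complex.I * (c : ℂ))).add
    (((act diracBeta).comp_memLp' h.1).const_smul ((m * c ^ 2 : ℝ) : ℂ))

lemma memLp_shellExpr {c m η τ : ℝ} {Ω : Set Space} (hΩ : IsOpen Ω) {f : Space → Spinor}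
    (h : MemDomain c η τ Ω f) : MemLp (shellExpr c m Ω f) 2 volume :=
  ((memLp_indicator_iff_restrict hΩ.measurableSet).mpr (memLp_diracExpr h.1)).add
    ((memLp_indicator_iff_restrict isClosed_closure.isOpen_compl.measurableSet).mpr
      (memLp_diracExpr h.2.1))

lemma diracExpr_add {c m : ℝ} {Ω : Set Space} (hΩ : IsOpen Ω) {f f' k : Space → Spinor}
    (h : MemH1 Ω f) (h' : MemH1 Ω f') (hk : k =ᵐ[volume.restrict Ω] f + f') :
    diracExpr c m Ω k =ᵐ[volume.restrict Ω] diracExpr c m Ω f + diracExpr c m Ω f' := by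
  filter_upwards [hk, ae_all_iff.mpr fun j => weakPartial_add hΩ h h' hk j] with x hx hw
  simp only [diracExpr, Pi.add_apply, hx, hw, map_add, Finset.sum_add_distrib, smul_add]
  abel

lemma diracExpr_smul {c m : ℝ} {Ω : Set Space} (hΩ : IsOpen Ω) {f k : Space → Spinor} (a : ℂ)
    (h : MemH1 Ω f) (hk : k =ᵐ[volume.restrict Ω] a • f) :
    diracExpr c m Ω k =ᵐ[volume.restrict Ω] a • diracExpr c m Ω f := by
  filter_upwards [hk, ae_all_iff.mpr fun j => weakPartial_smul hΩ a h hk j] with x hx hw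
  simp only [diracExpr, Pi.smul_apply, hx, hw, map_smul, ← Finset.smul_sum, smul_add]
  rw [smul_comm _ a, smul_comm _ a]

lemma shellExpr_add {c m η τ : ℝ} {Ω : Set Space} (hΩ : IsOpen Ω) {f f' k : Space → Spinor}
    (h : MemDomain c η τ Ω f) (h' : MemDomain c η τ Ω f') (hk : k =ᵐ[volume] f + f') :
    shellExpr c m Ω k =ᵐ[volume] shellExpr c m Ω f + shellExpr c m Ω f' := by
  have hΩ' : IsOpen (exterior Ω) := isClosed_closure.isOpen_compl
  have h1 := (ae_restrict_iff' hΩ.measurableSet).mp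
    (diracExpr_add (c := c) (m := m) hΩ h.1 h'.1 (ae_restrict_of_ae hk))
  have h2 := (ae_restrict_iff' hΩ'.measurableSet).mp
    (diracExpr_add (c := c) (m := m) hΩ' h.2.1 h'.2.1 (ae_restrict_of_ae hk))
  filter_upwards [h1, h2] with x hx1 hx2
  simp only [shellExpr, Pi.add_apply, Set.indicator] at *
  split_ifs with a b b
  · rw [hx1 a, hx2 b]; abel
  · rw [hx1 a]; abel
  · rw [hx2 b]; abel
  · simp

lemma shellExpr_smul {c m η τ : ℝ} {Ω : Set Space} (hΩ : IsOpen Ω) {f k : Space → Spinor} (a : ℂ)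
    (h : MemDomain c η τ Ω f) (hk : k =ᵐ[volume] a • f) :
    shellExpr c m Ω k =ᵐ[volume] a • shellExpr c m Ω f := by
  have hΩ' : IsOpen (exterior Ω) := isClosed_closure.isOpen_compl
  have h1 := (ae_restrict_iff' hΩ.measurableSet).mp
    (diracExpr_smul (c := c) (m := m) hΩ a h.1 (ae_restrict_of_ae hk))
  have h2 := (ae_restrict_iff' hΩ'.measurableSet).mp
    (diracExpr_smul (c := c) (m := m) hΩ' a h.2.1 (ae_restrict_of_ae hk))
  filter_upwards [h1, h2] with x hx1 hx2
  simp only [shellExpr, Pi.add_apply, Pi.smul_apply, Set.indicator, smul_add] at *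
  split_ifs with a b b
  · rw [hx1 a, hx2 b]
  · rw [hx1 a]; simp
  · rw [hx2 b]; simp
  · simp

lemma IsLocalDefiningFunction.eq_zero {Ω : Set Space} (hΩ : IsOpen Ω) {x : Space}
    {ρ : Space → ℝ} (hx : x ∈ frontier Ω) (h : IsLocalDefiningFunction Ω x ρ) : ρ x = 0 := by
  have hxΩ : x ∉ Ω := fun hh => by
    rw [hΩ.frontier_eq] at hx
    exact hx.2 hh
  refine le_antisymm ?_ (not_lt.mp fun hlt => hxΩ (h.2.2.self_of_nhds.mpr hlt))
  by_contra! hpos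
  have hev : ∀ᶠ y in 𝓝 x, y ∉ Ω := by
    filter_upwards [h.2.2, h.1.continuousAt.eventually (lt_mem_nhds hpos)] with y hy hy'
    exact fun hyΩ => lt_asymm hy' (hy.mp hyΩ)
  have hcl := mem_closure_iff_frequently.mp (frontier_subset_closure hx)
  exact hcl hev

lemma IsLocalDefiningFunction.hasDerivAt {Ω : Set Space} {x : Space}
    {ρ : Space → ℝ} (h : IsLocalDefiningFunction Ω x ρ) (v : Space) :
    HasDerivAt (fun t : ℝ => ρ (x + t • v)) (inner ℝ (gradient ρ x) v) 0 := by
  have hd : HasFDerivAt ρ (fderiv ℝ ρ x) (x + (0 : ℝ) • v) := by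
    rw [zero_smul, add_zero]
    exact (h.1.differentiableAt (by simp)).hasFDerivAt
  have hp : HasDerivAt (fun t : ℝ => x + t • v) v 0 := by
    simpa using ((hasDerivAt_id (0 : ℝ)).smul_const v).const_add x
  have := hd.comp_hasDerivAt (0 : ℝ) hp
  rwa [show inner ℝ (gradient ρ x) v = fderiv ℝ ρ x v by
    rw [gradient, InnerProductSpace.toDual_symm_apply]]

/-- Two outward unit normals at the same boundary point agree, so `outwardNormal` is the outward
unit normal. -/
lemma IsOutwardUnitNormal.unique {Ω : Set Space} (hΩ : IsOpen Ω) {x n n' : Space}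
    (hx : x ∈ frontier Ω) (h : IsOutwardUnitNormal Ω x n) (h' : IsOutwardUnitNormal Ω x n') :
    n = n' := by
  obtain ⟨ρ, hρ, rfl⟩ := h
  obtain ⟨ρ', hρ', rfl⟩ := h'
  have key : ∀ v : Space, inner ℝ (gradient ρ x) v < 0 → inner ℝ (gradient ρ' x) v ≤ 0 := by
    intro v hv
    by_contra! hv'
    have h0 : Tendsto (fun t : ℝ => x + t • v) (𝓝[>] 0) (𝓝 x) := by
      have : Continuous fun t : ℝ => x + t • v := by fun_prop
      simpa using (this.tendsto 0).mono_left nhdsWithin_le_nhds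
    have d1 := (hasDerivAt_iff_tendsto_slope_zero.mp (hρ.hasDerivAt v)).mono_left
      (nhdsGT_le_nhdsNE (0 : ℝ)) |>.eventually (gt_mem_nhds hv)
    have d2 := (hasDerivAt_iff_tendsto_slope_zero.mp (hρ'.hasDerivAt v)).mono_left
      (nhdsGT_le_nhdsNE (0 : ℝ)) |>.eventually (lt_mem_nhds hv')
    obtain ⟨t, ht, h1, h2, h3, h4⟩ := ((eventually_mem_nhdsWithin (s := Set.Ioi (0 : ℝ))).and (d1.and (d2.and
      ((h0.eventually hρ.2.2).and (h0.eventually hρ'.2.2))))).exists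
    have ht' : (0 : ℝ) < t⁻¹ := inv_pos.mpr ht
    simp only [zero_add, zero_smul, add_zero, hρ.eq_zero hΩ hx, hρ'.eq_zero hΩ hx, sub_zero,
      smul_eq_mul] at h1 h2
    have hin : x + t • v ∈ Ω := h3.mpr (not_le.mp fun hc => h1.not_ge (mul_nonneg ht'.le hc))
    have := h4.mp hin
    exact h2.not_ge (mul_nonpos_of_nonneg_of_nonpos ht'.le this.le)
  by_contra hne
  have hn : ∀ w : Space, w ≠ 0 → ‖‖w‖⁻¹ • w‖ = 1 := fun w hw => by
    rw [norm_smul, norm_inv, norm_norm, inv_mul_cancel₀ (norm_ne_zero_iff.mpr hw)]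
  have hlt := (inner_lt_one_iff_real_of_norm_eq_one (hn _ hρ.2.1) (hn _ hρ'.2.1)).mpr hne
  set a := gradient ρ x
  set b := gradient ρ' x
  have ha : 0 < ‖a‖⁻¹ := inv_pos.mpr (norm_pos_iff.mpr hρ.2.1)
  have hb : 0 < ‖b‖⁻¹ := inv_pos.mpr (norm_pos_iff.mpr hρ'.2.1)
  have haa := real_inner_self_eq_norm_sq (‖a‖⁻¹ • a)
  have hbb := real_inner_self_eq_norm_sq (‖b‖⁻¹ • b)
  rw [hn _ hρ.2.1] at haa
  rw [hn _ hρ'.2.1] at hbb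
  have i1 : inner ℝ (‖a‖⁻¹ • a) (‖b‖⁻¹ • b - ‖a‖⁻¹ • a) < 0 := by
    rw [inner_sub_right, haa]; linarith
  have i2 : 0 < inner ℝ (‖b‖⁻¹ • b) (‖b‖⁻¹ • b - ‖a‖⁻¹ • a) := by
    rw [inner_sub_right, hbb, real_inner_comm]; linarith
  rw [real_inner_smul_left] at i1 i2
  have j1 := key _ (not_le.mp fun hc => i1.not_ge (mul_nonneg ha.le hc))
  exact i2.not_ge (mul_nonpos_of_nonneg_of_nonpos hb.le j1)

lemma isOutwardUnitNormal_outwardNormal {Ω : Set Space} {x : Space} {ρ : Space → ℝ}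
    (h : IsLocalDefiningFunction Ω x ρ) : IsOutwardUnitNormal Ω x (outwardNormal Ω x) := by
  have h' : ∃ n, IsOutwardUnitNormal Ω x n := ⟨_, ρ, h, rfl⟩
  rw [outwardNormal, dif_pos h']
  exact h'.choose_spec

/-! #### The operator `A_{η,τ}` and its eigenvalues -/

/-- The operator `A_{η,τ}` in `L²(ℝ³)⁴`. -/
noncomputable def diracShell (c m : ℝ) (Ω : BoundedC2Domain) (η τ : ℝ) :
    HilbertL2 →ₗ.[ℂ] HilbertL2 where
  domain :=
    { carrier := {f | MemDomain c η τ Ω.carrier f}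
      add_mem' := fun {f g} hf hg => MemDomain.add Ω.isOpen hf hg (Lp.coeFn_add f g)
      zero_mem' := memDomain_zero Ω.isOpen (Lp.coeFn_zero Spinor 2 volume)
      smul_mem' := fun a f hf => MemDomain.smul Ω.isOpen a hf (Lp.coeFn_smul a f) }
  toFun :=
    { toFun := fun f => (memLp_shellExpr (c := c) (m := m) Ω.isOpen f.2).toLp
        (shellExpr c m Ω.carrier f.1)
      map_add' := fun f g => by
        rw [← MemLp.toLp_add]
        exact MemLp.toLp_congr _ _ (shellExpr_add Ω.isOpen f.2 g.2 (Lp.coeFn_add f.1 g.1))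
      map_smul' := fun a f => by
        rw [RingHom.id_apply, ← MemLp.toLp_const_smul]
        exact MemLp.toLp_congr _ _ (shellExpr_smul Ω.isOpen a f.2 (Lp.coeFn_smul a f.1)) }

/-- The eigenspace `ker (A - z)` of an operator `A` in a complex vector space. -/
def eigenspace {H : Type} [AddCommGroup H] [Module ℂ H] (A : H →ₗ.[ℂ] H) (z : ℂ) :
    Submodule ℂ A.domain :=
  LinearMap.ker (A.toFun - z • A.domain.subtype)

/-- The point spectrum `σ_p(A)`: the set of all eigenvalues of `A`. -/
def pointSpectrum {H : Type} [AddCommGroup H] [Module ℂ H] (A : H →ₗ.[ℂ] H) : Set ℂ :=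
  {z | ∃ f : A.domain, f ≠ 0 ∧ A f = z • (f : H)}

/-- The multiplicity of `z` as an eigenvalue of `A`: the dimension of `ker (A - z)`. -/
noncomputable def eigenvalueMultiplicity {H : Type} [AddCommGroup H] [Module ℂ H] (A : H →ₗ.[ℂ] H) (z : ℂ) :
    Cardinal :=
  Module.rank ℂ (eigenspace A z)

end DiracShell

namespace DiracShell

/-! ### Calculus of compactly supported functions -/

/-! Each assertion comes from a symmetry acting pointwise on spinors, compatible with the
differential expression and with the coupling condition.

For (i), keep `f₊` and replace `f₋` by `-f₋`. The expression acts separately on the two sides, so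
only the coupling changes: jump and sum trade places. Since `(α·ν)² = 1` and `α·ν` anticommutes with
`β`, solving for the new jump gives a condition of the same type with the stated parameters
(`IsCoupled.neg_right`). The parameter map is an involution, which gives both directions.

For (iii), a matrix anticommuting with every `αⱼ` and with `β` reverses the sign of the Dirac
expression and turns `η` into `-η` (`isCoupled_chirality`).

For (ii), time reversal is antilinear, squares to `-1`, commutes with the Dirac expression and
preserves the coupling because `η` and `τ` are real. It maps `ker (A - z)` to `ker (A - z̄)`. For
real `z` it is a quaternionic structure on the eigenspace, whose dimension is then even: a matrix
with `M M̄ = -1` has `|det M|² = (-1)ⁿ` (`even_rank_of_antilinear`).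

What remains is that every eigenvalue is real, and most of the work serves this
(`IsEigenfunction.im_eq_zero`). By Green's formula, `Im ⟨f, A f⟩` is a difference of boundary
integrals of the normal currents `⟨f±, (α·ν) f±⟩`, and the coupling condition makes these currents
equal.

Green's formula needs a divergence theorem on `C²` domains. It suffices to have it for some measure
`μ ≤ K σ`, with `σ` the surface measure: traces are `L²(σ)` limits, hence `L²(μ)` limits, and
conditions holding `σ`-a.e. hold `μ`-a.e. So `σ` is never computed on graphs. Such a `μ` is built
locally from Fubini's theorem and the fundamental theorem of calculus, then glued by a partition of
unity. -/

lemma contDiff_of_forall_mem_tsupport {f : Space → ℝ} {n : WithTop ℕ∞}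
    (h : ∀ x ∈ tsupport f, ContDiffAt ℝ n f x) : ContDiff ℝ n f := by
  rw [contDiff_iff_contDiffAt]
  intro x
  by_cases hx : x ∈ tsupport f
  · exact h x hx
  · exact contDiffAt_const.congr_of_eventuallyEq (notMem_tsupport_iff_eventuallyEq.mp hx)

lemma fderiv_eq_zero_of_notMem_tsupport {f : Space → ℝ} {x : Space} (hx : x ∉ tsupport f) :
    fderiv ℝ f x = 0 := by
  rw [(notMem_tsupport_iff_eventuallyEq.mp hx).fderiv_eq]
  exact fderiv_const_apply 0

lemma integrable_fderiv_apply {φ : Space → ℝ} (hφ : ContDiff ℝ 1 φ) (hc : HasCompactSupport φ)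
    (v : Space) : Integrable (fun x => fderiv ℝ φ x v) :=
  ((hφ.continuous_fderiv (by simp)).clm_apply continuous_const).integrable_of_hasCompactSupport
    (hc.fderiv_apply (𝕜 := ℝ) v)

lemma integral_fderiv_apply_eq_zero {φ : Space → ℝ} (hφ : ContDiff ℝ 1 φ)
    (hc : HasCompactSupport φ) (v : Space) : ∫ x, fderiv ℝ φ x v = 0 := by
  have := integral_mul_fderiv_eq_neg_fderiv_mul_of_integrable (𝕜 := ℝ) (f := fun _ : Space => (1 : ℝ))
    (g := φ) (v := v) (μ := volume) (by simp)
    (by simpa using integrable_fderiv_apply hφ hc v)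
    (by simpa using hφ.continuous.integrable_of_hasCompactSupport hc)
    (fun x _ => by fun_prop) (fun x _ => hφ.differentiable (by simp) x)
  simpa using this

/-- The vector field `φ v - w e` is tangential to the level sets of `ρ`, so its divergence has
vanishing integral over the sublevel set `{ρ < 0}`. -/
lemma setIntegral_fderiv_eq_of_tangential {Ω U : Set Space} (hΩ : IsOpen Ω)
    {ρ φ w : Space → ℝ} (hρ : ∀ x ∈ U, ContDiffAt ℝ 1 ρ x) (hΩU : ∀ x ∈ U, (x ∈ Ω ↔ ρ x < 0))
    (hφ : ContDiff ℝ 1 φ) (hφc : HasCompactSupport φ) (hφU : tsupport φ ⊆ U)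
    (hw : ContDiff ℝ 1 w) (hwc : HasCompactSupport w) (hwU : tsupport w ⊆ U) (v e : Space)
    (h : ∀ x ∈ U, φ x * fderiv ℝ ρ x v = w x * fderiv ℝ ρ x e) :
    ∫ x in Ω, fderiv ℝ φ x v = ∫ x in Ω, fderiv ℝ w x e := by
  -- The cutoff `χ n ∘ ρ` is `0` where `ρ ≥ 0` and `1` where `ρ ≤ -1/n`, so on `U` it tends
  -- pointwise to the indicator of `Ω`.
  set χ : ℕ → ℝ → ℝ := fun n s => Real.smoothTransition (-(n * s)) with hχ
  have hχd : ∀ n, ContDiff ℝ 1 (χ n) := fun n =>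
    (Real.smoothTransition.contDiff (n := 1)).comp (by fun_prop)
  have hF : ∀ n (φ : Space → ℝ), ContDiff ℝ 1 φ → tsupport φ ⊆ U →
      ContDiff ℝ 1 (fun x => χ n (ρ x) * φ x) := by
    intro n φ hφ hφU
    refine contDiff_of_forall_mem_tsupport fun x hx => ?_
    have hxU : x ∈ U := hφU (closure_mono (Function.support_mul_subset_right _ _) hx)
    exact ((hχd n).contDiffAt.comp x (hρ x hxU)).mul hφ.contDiffAt
  have hFc : ∀ n (φ : Space → ℝ), HasCompactSupport φ →
      HasCompactSupport (fun x => χ n (ρ x) * φ x) := fun n φ hc => hc.mul_left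
  have hFd : ∀ n (φ : Space → ℝ), ContDiff ℝ 1 φ → ∀ x ∈ U, ∀ v,
      fderiv ℝ (fun x => χ n (ρ x) * φ x) x v
        = χ n (ρ x) * fderiv ℝ φ x v + deriv (χ n) (ρ x) * (φ x * fderiv ℝ ρ x v) := by
    intro n φ hφ x hx v
    have h1 : HasFDerivAt (fun x => χ n (ρ x)) (deriv (χ n) (ρ x) • fderiv ℝ ρ x) x :=
      ((hχd n).differentiable (by simp) _).hasDerivAt.comp_hasFDerivAt x
        ((hρ x hx).differentiableAt (by simp)).hasFDerivAt
    rw [show (fun x => χ n (ρ x) * φ x) = (fun x => χ n (ρ x)) * φ from rfl,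
      (h1.mul (hφ.differentiable (by simp) x).hasFDerivAt).fderiv]
    simp only [_root_.add_apply, _root_.smul_apply, smul_eq_mul]
    ring
  have hout : ∀ n (φ : Space → ℝ), tsupport φ ⊆ U → ∀ x, x ∉ U → ∀ v,
      fderiv ℝ (fun x => χ n (ρ x) * φ x) x v = 0 ∧ fderiv ℝ φ x v = 0 := by
    intro n φ hφU x hx v
    rw [fderiv_eq_zero_of_notMem_tsupport (fun hh => hx (hφU hh)),
      fderiv_eq_zero_of_notMem_tsupport fun hh =>
        hx (hφU (closure_mono (Function.support_mul_subset_right _ _) hh))]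
    simp
  set g : Space → ℝ := fun x => fderiv ℝ φ x v - fderiv ℝ w x e with hg
  have hgi : Integrable g := (integrable_fderiv_apply hφ hφc v).sub (integrable_fderiv_apply hw hwc e)
  -- The derivatives of the cutoff, of size `n`, enter only through `φ ∂ᵥρ - w ∂ₑρ`, which vanishes
  -- by tangency. The cut-off integrand is therefore an exact derivative for every `n`.
  have hgn : ∀ n, (fun x => χ n (ρ x) * g x) = fun x =>
      fderiv ℝ (fun x => χ n (ρ x) * φ x) x v - fderiv ℝ (fun x => χ n (ρ x) * w x) x e := by
    intro n
    funext x
    by_cases hx : x ∈ U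
    · rw [hFd n φ hφ x hx, hFd n w hw x hx, h x hx]
      ring
    · rw [(hout n φ hφU x hx v).1, (hout n w hwU x hx e).1]
      simp [hg, (hout n φ hφU x hx v).2, (hout n w hwU x hx e).2]
  have hzero : ∀ n, ∫ x, χ n (ρ x) * g x = 0 := by
    intro n
    rw [hgn, integral_sub (integrable_fderiv_apply (hF n φ hφ hφU) (hFc n φ hφc) v)
      (integrable_fderiv_apply (hF n w hw hwU) (hFc n w hwc) e),
      integral_fderiv_apply_eq_zero (hF n φ hφ hφU) (hFc n φ hφc),
      integral_fderiv_apply_eq_zero (hF n w hw hwU) (hFc n w hwc), sub_zero]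
  have hlim : Tendsto (fun n => ∫ x, χ n (ρ x) * g x) atTop (𝓝 (∫ x, Ω.indicator g x)) := by
    refine tendsto_integral_of_dominated_convergence (fun x => ‖g x‖) (fun n => ?_) hgi.norm
      (fun n => ae_of_all _ fun x => ?_) (ae_of_all _ fun x => ?_)
    · rw [hgn]
      exact ((integrable_fderiv_apply (hF n φ hφ hφU) (hFc n φ hφc) v).sub
        (integrable_fderiv_apply (hF n w hw hwU) (hFc n w hwc) e)).aestronglyMeasurable
    · rw [norm_mul]
      refine mul_le_of_le_one_left (norm_nonneg _) ?_
      rw [Real.norm_of_nonneg (Real.smoothTransition.nonneg _)]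
      exact Real.smoothTransition.le_one _
    · by_cases hx : x ∈ U
      · by_cases hxΩ : x ∈ Ω
        · rw [Set.indicator_of_mem hxΩ]
          have hneg : 0 < -ρ x := neg_pos.mpr ((hΩU x hx).mp hxΩ)
          refine tendsto_const_nhds.congr' ?_
          filter_upwards [(tendsto_natCast_atTop_atTop.atTop_mul_const hneg).eventually_ge_atTop 1]
            with n hn
          rw [hχ]
          simp only
          rw [Real.smoothTransition.one_of_one_le (by linarith), one_mul]
        · rw [Set.indicator_of_notMem hxΩ]
          have hpos : 0 ≤ ρ x := not_lt.mp fun hh => hxΩ ((hΩU x hx).mpr hh)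
          refine tendsto_const_nhds.congr fun n => ?_
          rw [hχ]
          simp only
          rw [Real.smoothTransition.zero_of_nonpos (by
            have : 0 ≤ (n : ℝ) * ρ x := by positivity
            linarith), zero_mul]
      · have : g x = 0 := by
          simp [hg, (hout 0 φ hφU x hx v).2, (hout 0 w hwU x hx e).2]
        simp [this, Set.indicator]
  simp_rw [hzero] at hlim
  have := tendsto_nhds_unique tendsto_const_nhds hlim
  rw [integral_indicator hΩ.measurableSet, hg, integral_sub
    (integrable_fderiv_apply hφ hφc v).integrableOn
    (integrable_fderiv_apply hw hwc e).integrableOn] at this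
  linarith

/-! ### Slicing space along a coordinate direction -/

/-- The coordinates `(t, y)` of `ℝ³` in which `t` is `s` times the `k`-th Cartesian coordinate and
`y` collects the other two. -/
noncomputable def slicing (k : Fin 3) (s : ℝ) (hs : s * s = 1) :
    ℝ × EuclideanSpace ℝ (Fin 2) ≃ₜ Space where
  toFun p := WithLp.toLp 2 (k.insertNth (α := fun _ => ℝ) (s * p.1) p.2.ofLp)
  invFun x := (s * x k, WithLp.toLp 2 fun i => x (k.succAbove i))
  left_inv p := by
    refine Prod.ext ?_ ?_
    · simp [← mul_assoc, hs]
    · ext i; simp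
  right_inv x := by
    ext i
    refine Fin.succAboveCases k ?_ (fun i => ?_) i
    · simp [← mul_assoc, hs]
    · simp
  continuous_toFun := by
    refine (PiLp.continuous_toLp 2 _).comp (continuous_pi fun i => ?_)
    refine Fin.succAboveCases k ?_ (fun i => ?_) i
    · simp only [Fin.insertNth_apply_same]; fun_prop
    · simp only [Fin.insertNth_apply_succAbove]; fun_prop
  continuous_invFun := by fun_prop

lemma slicing_apply (k : Fin 3) (s : ℝ) (hs : s * s = 1) (t : ℝ) (y : EuclideanSpace ℝ (Fin 2)) :
    slicing k s hs (t, y) = slicing k s hs (0, y) + t • s • EuclideanSpace.single k (1 : ℝ) := by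
  ext i
  refine Fin.succAboveCases k ?_ (fun i => ?_) i
  · simp [slicing, mul_comm]
  · simp [slicing]

/-- Dropping one coordinate shortens distances. This is what later bounds Lebesgue measure on the
base of a graph by Hausdorff measure on the graph. -/
lemma lipschitzWith_slicing_symm_snd (k : Fin 3) (s : ℝ) (hs : s * s = 1) :
    LipschitzWith 1 fun x => ((slicing k s hs).symm x).2 := by
  refine LipschitzWith.of_dist_le_mul fun x y => ?_
  rw [NNReal.coe_one, one_mul, EuclideanSpace.dist_eq, EuclideanSpace.dist_eq]
  refine Real.sqrt_le_sqrt ?_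
  rw [Fin.sum_univ_succAbove (fun i => dist (x i) (y i) ^ 2) k]
  exact le_add_of_nonneg_left (sq_nonneg _)

lemma measurePreserving_slicing (k : Fin 3) (s : ℝ) (hs : s * s = 1) :
    MeasurePreserving (slicing k s hs) := by
  have h1 : MeasurePreserving (fun t : ℝ => s * t) := by
    rcases mul_self_eq_one_iff.mp hs with rfl | rfl
    · simp only [one_mul]
      exact MeasurePreserving.id volume
    · simp only [neg_one_mul]
      exact Measure.measurePreserving_neg (volume : Measure ℝ)
  have h2 := EuclideanSpace.volume_preserving_symm_measurableEquiv_toLp (Fin 2)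
  have h3 := (volume_preserving_piFinSuccAbove (fun _ : Fin 3 => ℝ) k).symm
  have h4 := PiLp.volume_preserving_toLp (Fin 3)
  exact h4.comp (h3.comp (h1.prod h2))

/-! ### Local graph representation of the boundary -/

lemma hasDerivAt_slicing (k : Fin 3) (s : ℝ) (hs : s * s = 1) (t : ℝ)
    (y : EuclideanSpace ℝ (Fin 2)) :
    HasDerivAt (fun t => slicing k s hs (t, y)) (s • EuclideanSpace.single k (1 : ℝ)) t := by
  rw [funext fun t => slicing_apply k s hs t y]
  have := ((hasDerivAt_id t).smul_const
    (s • EuclideanSpace.single k (1 : ℝ))).const_add (slicing k s hs (0, y))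
  rw [one_smul] at this
  exact this

/-- On each line in the direction `s eₖ` the function `ρ` is strictly increasing, so it has one zero
there, by the intermediate value theorem. The height function `h` is only required to be measurable,
so the implicit function theorem is not needed. -/
lemma exists_graph_patch {Ω U : Set Space} (hΩ : IsOpen Ω) (hU : IsOpen U) {ρ : Space → ℝ}
    (hρ : ∀ x ∈ U, ContDiffAt ℝ 1 ρ x) (hΩU : ∀ x ∈ U, (x ∈ Ω ↔ ρ x < 0))
    (hfr : ∀ x ∈ U, x ∈ frontier Ω → ρ x = 0) (k : Fin 3) (s : ℝ) (hs : s * s = 1)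
    (hpos : ∀ x ∈ U, 0 < fderiv ℝ ρ x (s • EuclideanSpace.single k (1 : ℝ)))
    {x₀ : Space} (hx₀ : x₀ ∈ U) (h₀ : ρ x₀ = 0) :
    ∃ (a b : ℝ) (V : Set (EuclideanSpace ℝ (Fin 2))) (h : EuclideanSpace ℝ (Fin 2) → ℝ),
      IsOpen V ∧ volume V ≠ ⊤ ∧ Measurable h ∧ x₀ ∈ slicing k s hs '' (Set.Ioo a b ×ˢ V) ∧
      ∀ y ∈ V, h y ∈ Set.Ioo a b ∧ ∀ t ∈ Set.Icc a b, slicing k s hs (t, y) ∈ U ∧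
        (slicing k s hs (t, y) ∈ Ω ↔ t < h y) ∧
        (slicing k s hs (t, y) ∈ frontier Ω ↔ t = h y) := by
  set Φ := slicing k s hs with hΦ
  set e : Space := s • EuclideanSpace.single k (1 : ℝ) with he
  obtain ⟨⟨t₀, y₀⟩, hty⟩ := Φ.surjective x₀
  have hder : ∀ t y, Φ (t, y) ∈ U →
      HasDerivAt (fun t => ρ (Φ (t, y))) (fderiv ℝ ρ (Φ (t, y)) e) t := by
    intro t y hm
    have h1 : HasDerivAt (fun t => Φ (t, y)) e t := hasDerivAt_slicing k s hs t y
    exact ((hρ _ hm).differentiableAt (by simp)).hasFDerivAt.comp_hasDerivAt t h1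
  have hΦc : ∀ y, Continuous fun t => Φ (t, y) := fun y =>
    Φ.continuous.comp (by fun_prop)
  have hnhds : Φ ⁻¹' U ∈ 𝓝 (t₀, y₀) :=
    (hU.preimage Φ.continuous).mem_nhds (by simpa [hty] using hx₀)
  obtain ⟨r, hr, hrU⟩ := Metric.mem_nhds_iff.mp hnhds
  -- Half the radius keeps the closed segment inside the open ball, endpoints included.
  set a := t₀ - r / 2 with ha
  set b := t₀ + r / 2 with hb
  have hab : a < b := by linarith
  have hin : ∀ y ∈ Metric.ball y₀ r, ∀ t ∈ Set.Icc a b, Φ (t, y) ∈ U := by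
    intro y hy t ht
    refine hrU ?_
    rw [Metric.mem_ball, Prod.dist_eq, max_lt_iff]
    refine ⟨?_, hy⟩
    rw [Real.dist_eq, abs_lt]
    constructor <;> linarith [ht.1, ht.2]
  have hmono : ∀ y ∈ Metric.ball y₀ r, StrictMonoOn (fun t => ρ (Φ (t, y))) (Set.Icc a b) := by
    intro y hy
    refine strictMonoOn_of_deriv_pos (convex_Icc a b) (fun t ht =>
      (hder t y (hin y hy t ht)).continuousAt.continuousWithinAt) fun t ht => ?_
    have ht' := hin y hy t (interior_subset ht)
    rw [(hder t y ht').deriv]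
    exact hpos _ ht'
  have hy₀ : y₀ ∈ Metric.ball y₀ r := Metric.mem_ball_self hr
  have ha0 : ρ (Φ (a, y₀)) < 0 := by
    rw [← h₀, ← hty]
    exact hmono y₀ hy₀ ⟨le_rfl, hab.le⟩ ⟨by linarith, by linarith⟩ (by linarith)
  have hb0 : 0 < ρ (Φ (b, y₀)) := by
    rw [← h₀, ← hty]
    exact hmono y₀ hy₀ ⟨by linarith, by linarith⟩ ⟨hab.le, le_rfl⟩ (by linarith)
  have hcy : ∀ t ∈ Set.Icc a b, ContinuousAt (fun y => ρ (Φ (t, y))) y₀ := fun t ht =>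
    ContinuousAt.comp (f := fun y => Φ (t, y)) (hρ _ (hin y₀ hy₀ t ht)).continuousAt
      (Φ.continuous.comp (by fun_prop : Continuous fun y => (t, y))).continuousAt
  have hev : ∀ᶠ y in 𝓝 y₀, ρ (Φ (a, y)) < 0 ∧ 0 < ρ (Φ (b, y)) ∧ y ∈ Metric.ball y₀ r :=
    ((hcy a ⟨le_rfl, hab.le⟩).eventually (gt_mem_nhds ha0)).and
      (((hcy b ⟨hab.le, le_rfl⟩).eventually (lt_mem_nhds hb0)).and (Metric.ball_mem_nhds y₀ hr))
  obtain ⟨V, hVsub, hV, hyV⟩ := eventually_nhds_iff.mp hev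
  have hgraph : ∀ y ∈ V, ∃ τ ∈ Set.Ioo a b, ∀ t ∈ Set.Icc a b, Φ (t, y) ∈ U ∧
      (Φ (t, y) ∈ Ω ↔ t < τ) ∧ (Φ (t, y) ∈ frontier Ω ↔ t = τ) := by
    intro y hy
    obtain ⟨hya, hyb, hyr⟩ := hVsub y hy
    have hm := hmono y hyr
    obtain ⟨τ, hτ, hτ0⟩ := intermediate_value_Ioo hab.le (fun t ht =>
      (hder t y (hin y hyr t ht)).continuousAt.continuousWithinAt) ⟨hya, hyb⟩
    simp only at hτ0
    have hτ' := Set.Ioo_subset_Icc_self hτ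
    have hΩt : ∀ t ∈ Set.Icc a b, (Φ (t, y) ∈ Ω ↔ t < τ) := by
      intro t ht
      rw [hΩU _ (hin y hyr t ht), ← hτ0]
      exact hm.lt_iff_lt ht hτ'
    refine ⟨τ, hτ, fun t ht => ⟨hin y hyr t ht, hΩt t ht, fun hf => ?_, ?_⟩⟩
    · have := hfr _ (hin y hyr t ht) hf
      exact hm.injOn ht hτ' (this.trans hτ0.symm)
    · rintro rfl
      -- The graph point is not in `Ω`, but it is a limit of points of `Ω` lying below it on the
      -- same line.
      rw [hΩ.frontier_eq]
      refine ⟨?_, fun hh => lt_irrefl _ ((hΩt t ht).mp hh)⟩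
      refine (hΦc y).continuousWithinAt.mem_closure (s := Set.Ioo a t) (x := t) ?_ fun u hu =>
        (hΩt u ⟨hu.1.le, hu.2.le.trans hτ.2.le⟩).mpr hu.2
      rw [closure_Ioo hτ.1.ne]
      exact ⟨hτ.1.le, le_rfl⟩
  -- The height is recovered as `a` plus the length of the slice of `Ω` over `y`. Slice lengths are
  -- measurable in `y` by Tonelli, whereas the zeros `τ` are only given pointwise.
  set S : Set (ℝ × EuclideanSpace ℝ (Fin 2)) := (Prod.fst ⁻¹' Set.Ioo a b) ∩ Φ ⁻¹' Ω with hS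
  have hSm : MeasurableSet S :=
    (measurable_fst measurableSet_Ioo).inter (Φ.continuous.measurable hΩ.measurableSet)
  refine ⟨a, b, V, fun y => a + (volume ((fun t => (t, y)) ⁻¹' S)).toReal, hV,
    ((measure_mono fun y hy => (hVsub y hy).2.2).trans_lt measure_ball_lt_top).ne,
    (measurable_measure_prodMk_right hSm).ennreal_toReal.const_add a,
    ⟨(t₀, y₀), ⟨⟨by linarith, by linarith⟩, hyV⟩, hty⟩, fun y hy => ?_⟩
  obtain ⟨τ, hτ, hτs⟩ := hgraph y hy
  have hset : (fun t => (t, y)) ⁻¹' S = Set.Ioo a τ := by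
    ext t
    constructor
    · rintro ⟨h1, h2⟩
      exact ⟨h1.1, ((hτs t (Set.Ioo_subset_Icc_self h1)).2.1).mp h2⟩
    · intro h1
      have h2 : t ∈ Set.Ioo a b := ⟨h1.1, h1.2.trans hτ.2⟩
      exact ⟨h2, ((hτs t (Set.Ioo_subset_Icc_self h2)).2.1).mpr h1.2⟩
  have hτe : a + (volume ((fun t => (t, y)) ⁻¹' S)).toReal = τ := by
    rw [hset, Real.volume_Ioo, ENNReal.toReal_ofReal (by linarith [hτ.1])]
    ring
  simp only [hτe]
  exact ⟨hτ, hτs⟩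

/-- Integration of a directional derivative over the subgraph of `h`. -/
lemma setIntegral_fderiv_eq_graph {Ω : Set Space} (hΩ : IsOpen Ω) (k : Fin 3) (s : ℝ)
    (hs : s * s = 1) {a b : ℝ} {V : Set (EuclideanSpace ℝ (Fin 2))} (hV : IsOpen V)
    {h : EuclideanSpace ℝ (Fin 2) → ℝ}
    (hh : ∀ y ∈ V, h y ∈ Set.Ioo a b ∧ ∀ t ∈ Set.Icc a b, (slicing k s hs (t, y) ∈ Ω ↔ t < h y))
    {w : Space → ℝ} (hw : ContDiff ℝ 1 w) (hwc : HasCompactSupport w)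
    (hwU : tsupport w ⊆ slicing k s hs '' (Set.Ioo a b ×ˢ V)) :
    ∫ x in Ω, fderiv ℝ w x (s • EuclideanSpace.single k (1 : ℝ))
      = ∫ y in V, w (slicing k s hs (h y, y)) := by
  set Φ := slicing k s hs with hΦ
  set e : Space := s • EuclideanSpace.single k (1 : ℝ) with he
  have hder : ∀ t y, HasDerivAt (fun t => w (Φ (t, y))) (fderiv ℝ w (Φ (t, y)) e) t := by
    intro t y
    have h1 : HasDerivAt (fun t => Φ (t, y)) e t := hasDerivAt_slicing k s hs t y
    exact (hw.differentiable (by simp) _).hasFDerivAt.comp_hasDerivAt t h1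
  have hout : ∀ t y, (t, y) ∉ Set.Ioo a b ×ˢ V → Φ (t, y) ∉ tsupport w := by
    intro t y hty hh
    obtain ⟨p, hp, hpe⟩ := hwU hh
    exact hty (Φ.injective hpe ▸ hp)
  set g : Space → ℝ := Ω.indicator fun x => fderiv ℝ w x e with hg
  have hgi : Integrable g := (integrable_fderiv_apply hw hwc e).indicator hΩ.measurableSet
  have hmp := measurePreserving_slicing k s hs
  have hme : MeasurableEmbedding Φ := Φ.measurableEmbedding
  rw [← integral_indicator hΩ.measurableSet, ← hmp.integral_comp hme g,
    Measure.volume_eq_prod, integral_prod_symm (fun p => g (Φ p)) ((hmp.integrable_comp_emb hme).mpr hgi),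
    ← integral_indicator hV.measurableSet]
  congr 1
  funext y
  by_cases hy : y ∈ V
  · obtain ⟨hya, hyΩ⟩ := hh y hy
    rw [Set.indicator_of_mem hy]
    have hset : (fun t => g (Φ (t, y)))
        = (Set.Ioo a (h y)).indicator fun t => fderiv ℝ w (Φ (t, y)) e := by
      funext t
      by_cases ht : t ∈ Set.Ioo a b
      · have hiff := hyΩ t (Set.Ioo_subset_Icc_self ht)
        by_cases hth : t < h y
        · rw [hg, Set.indicator_of_mem (hiff.mpr hth), Set.indicator_of_mem (show t ∈ Set.Ioo a (h y) from ⟨ht.1, hth⟩)]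
        · rw [hg, Set.indicator_of_notMem (fun hc => hth (hiff.mp hc)),
            Set.indicator_of_notMem (fun hc => hth hc.2)]
      · have h0 := fderiv_eq_zero_of_notMem_tsupport (hout t y fun hc => ht hc.1)
        rw [Set.indicator_of_notMem (fun hc => ht ⟨hc.1, hc.2.trans hya.2⟩), hg]
        simp [Set.indicator, h0]
    -- Only the upper endpoint `h y` contributes: the lower endpoint `a` lies outside the open box
    -- containing the support of `w`.
    rw [hset, integral_indicator measurableSet_Ioo, ← integral_Ioc_eq_integral_Ioo,
      ← intervalIntegral.integral_of_le hya.1.le,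
      intervalIntegral.integral_eq_sub_of_hasDerivAt (fun t _ => hder t y) ?_,
      image_eq_zero_of_notMem_tsupport (hout a y fun hc => lt_irrefl _ hc.1.1), sub_zero]
    refine Continuous.intervalIntegrable ?_ _ _
    exact ((hw.continuous_fderiv (by simp)).clm_apply continuous_const).comp
      (Φ.continuous.comp (by fun_prop : Continuous fun t : ℝ => (t, y)))
  · rw [Set.indicator_of_notMem hy]
    have : ∀ t, g (Φ (t, y)) = 0 := fun t => by
      have h0 := fderiv_eq_zero_of_notMem_tsupport (hout t y fun hc => hy hc.2)
      simp [hg, Set.indicator, h0]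
    simp [this]

/-- Projections do not increase Hausdorff measure, so Lebesgue measure on the base of a graph in
the boundary is dominated by the surface measure. -/
lemma map_graph_le_surfaceMeasure {Ω : Set Space} (k : Fin 3) (s : ℝ) (hs : s * s = 1)
    {V : Set (EuclideanSpace ℝ (Fin 2))}
    {h : EuclideanSpace ℝ (Fin 2) → ℝ} (hm : Measurable h)
    (hh : ∀ y ∈ V, slicing k s hs (h y, y) ∈ frontier Ω) :
    (volume.restrict V).map (fun y => slicing k s hs (h y, y)) ≤ surfaceMeasure Ω := by
  have hγ : Measurable fun y => slicing k s hs (h y, y) :=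
    (slicing k s hs).continuous.measurable.comp (hm.prodMk measurable_id)
  refine Measure.le_iff.mpr fun E hE => ?_
  rw [Measure.map_apply hγ hE, Measure.restrict_apply (hγ hE), surfaceMeasure,
    Measure.restrict_apply hE]
  have hP := lipschitzWith_slicing_symm_snd k s hs
  calc volume ((fun y => slicing k s hs (h y, y)) ⁻¹' E ∩ V)
      ≤ volume ((fun x => ((slicing k s hs).symm x).2) '' (E ∩ frontier Ω)) := by
        refine measure_mono fun y hy => ⟨_, ⟨hy.1, hh y hy.2⟩, ?_⟩
        simp
    _ = Measure.euclideanHausdorffMeasure 2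
          ((fun x => ((slicing k s hs).symm x).2) '' (E ∩ frontier Ω)) := by
        rw [EuclideanSpace.euclideanHausdorffMeasure_eq_volume]
    _ ≤ Measure.euclideanHausdorffMeasure 2 (E ∩ frontier Ω) := by
        simp only [Measure.euclideanHausdorffMeasure_def, Measure.smul_apply]
        have := hP.hausdorffMeasure_image_le (d := ((2 : ℕ) : ℝ)) (by simp) (E ∩ frontier Ω)
        rw [ENNReal.coe_one, ENNReal.one_rpow, one_mul] at this
        gcongr

/-- Each line in the slicing direction meets `F` at most once inside the patch; Tonelli then gives
measure zero. -/
lemma volume_graph_patch_eq_zero {F : Set Space} (hF : IsClosed F) (k : Fin 3) (s : ℝ)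
    (hs : s * s = 1) {a b : ℝ} {V : Set (EuclideanSpace ℝ (Fin 2))} (hV : IsOpen V)
    {h : EuclideanSpace ℝ (Fin 2) → ℝ}
    (hh : ∀ y ∈ V, ∀ t ∈ Set.Ioo a b, slicing k s hs (t, y) ∈ F → t = h y) :
    volume (F ∩ slicing k s hs '' (Set.Ioo a b ×ˢ V)) = 0 := by
  have hmp := measurePreserving_slicing k s hs
  have hm : MeasurableSet (F ∩ slicing k s hs '' (Set.Ioo a b ×ˢ V)) :=
    hF.measurableSet.inter ((slicing k s hs).isOpenMap _ (isOpen_Ioo.prod hV)).measurableSet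
  rw [← hmp.measure_preimage hm.nullMeasurableSet, Measure.volume_eq_prod,
    Measure.prod_apply_symm (hmp.measurable hm), lintegral_eq_zero_iff' (by
      exact (measurable_measure_prodMk_right (hmp.measurable hm)).aemeasurable)]
  refine ae_of_all _ fun y => ?_
  refine measure_mono_null (t := {h y}) ?_ (by simp)
  rintro t ⟨h1, p, hp, hpe⟩
  have := (slicing k s hs).injective hpe
  subst this
  exact hh _ hp.2 _ hp.1 h1

/-! ### The divergence theorem -/

lemma gradient_apply (ρ : Space → ℝ) (x : Space) (j : Fin 3) :
    gradient ρ x j = fderiv ℝ ρ x (EuclideanSpace.single j 1) := by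
  have h : inner ℝ (gradient ρ x) (EuclideanSpace.single j (1 : ℝ))
      = fderiv ℝ ρ x (EuclideanSpace.single j 1) := by
    rw [gradient, InnerProductSpace.toDual_symm_apply]
  rw [← h, EuclideanSpace.inner_single_right]
  simp

lemma continuousAt_gradient {ρ : Space → ℝ} {x : Space} (h : ContDiffAt ℝ 2 ρ x) :
    ContinuousAt (gradient ρ) x :=
  (InnerProductSpace.toDual ℝ Space).symm.continuous.continuousAt.comp
    (h.fderiv_right (m := 1) (by norm_num)).continuousAt

lemma outwardNormal_eq {Ω : Set Space} (hΩ : IsOpen Ω) {x : Space} (hx : x ∈ frontier Ω)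
    {ρ : Space → ℝ} (h : IsLocalDefiningFunction Ω x ρ) :
    outwardNormal Ω x = ‖gradient ρ x‖⁻¹ • gradient ρ x :=
  (isOutwardUnitNormal_outwardNormal h).unique hΩ hx ⟨ρ, h, rfl⟩

/-- One defining function thus serves a whole neighbourhood, so the normals at nearby boundary
points share a single formula. -/
lemma IsLocalDefiningFunction.eventually {Ω : Set Space} {x : Space} {ρ : Space → ℝ}
    (h : IsLocalDefiningFunction Ω x ρ) : ∀ᶠ y in 𝓝 x, IsLocalDefiningFunction Ω y ρ :=
  (h.1.eventually (by simp)).and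
    (((continuousAt_gradient h.1).eventually_ne h.2.1).and (eventually_eventually_nhds.mpr h.2.2))

lemma norm_outwardNormal {Ω : Set Space} (hΩ : IsOpen Ω) {x : Space} (hx : x ∈ frontier Ω)
    {ρ : Space → ℝ} (h : IsLocalDefiningFunction Ω x ρ) : ‖outwardNormal Ω x‖ = 1 := by
  rw [outwardNormal_eq hΩ hx h, norm_smul, norm_inv, norm_norm,
    inv_mul_cancel₀ (norm_ne_zero_iff.mpr h.2.1)]

/-- The normal is selected by choice point by point, but uniqueness identifies it near each boundary
point with the normalised gradient of one `C²` function. Its measurability rests on this. -/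
lemma continuousOn_outwardNormal (Ω : BoundedC2Domain) :
    ContinuousOn (outwardNormal Ω.carrier) (frontier Ω.carrier) := by
  intro x hx
  obtain ⟨ρ, hρ⟩ := Ω.boundary_c2 x hx
  have hc : ContinuousAt (fun y => ‖gradient ρ y‖⁻¹ • gradient ρ y) x :=
    ((continuousAt_gradient hρ.1).norm.inv₀ (norm_ne_zero_iff.mpr hρ.2.1)).smul
      (continuousAt_gradient hρ.1)
  refine hc.continuousWithinAt.congr_of_eventuallyEq_of_mem ?_ hx
  filter_upwards [eventually_nhdsWithin_of_eventually_nhds hρ.eventually,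
    eventually_mem_nhdsWithin] with y hy hyf
  exact outwardNormal_eq Ω.isOpen hyf hy

lemma ae_surfaceMeasure_mem_frontier (Ω : Set Space) :
    ∀ᵐ x ∂(surfaceMeasure Ω), x ∈ frontier Ω :=
  ae_restrict_mem isClosed_frontier.measurableSet

lemma ae_norm_outwardNormal (Ω : BoundedC2Domain) :
    ∀ᵐ x ∂(surfaceMeasure Ω.carrier), ‖outwardNormal Ω.carrier x‖ = 1 := by
  filter_upwards [ae_surfaceMeasure_mem_frontier Ω.carrier] with x hx
  obtain ⟨ρ, hρ⟩ := Ω.boundary_c2 x hx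
  exact norm_outwardNormal Ω.isOpen hx hρ

lemma aestronglyMeasurable_outwardNormal (Ω : BoundedC2Domain) :
    AEStronglyMeasurable (outwardNormal Ω.carrier) (surfaceMeasure Ω.carrier) :=
  (continuousOn_outwardNormal Ω).aestronglyMeasurable isClosed_frontier.measurableSet

/-- `μ` is a finite measure, dominated by a multiple of the surface measure, for which the
divergence theorem holds for functions supported in `U`. -/
structure IsBoundaryMeasureOn (Ω U : Set Space) (μ : Measure Space) : Prop where
  isFinite : IsFiniteMeasure μ
  exists_le : ∃ K : NNReal, μ ≤ K • surfaceMeasure Ω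
  integral_eq : ∀ φ : Space → ℝ, ContDiff ℝ 1 φ → HasCompactSupport φ → tsupport φ ⊆ U → ∀ j,
    ∫ x in Ω, classicalPartial j φ x = ∫ x, φ x * outwardNormal Ω x j ∂μ

lemma IsBoundaryMeasureOn.absolutelyContinuous {Ω U : Set Space} {μ : Measure Space}
    (h : IsBoundaryMeasureOn Ω U μ) : μ ≪ surfaceMeasure Ω := by
  obtain ⟨K, hK⟩ := h.exists_le
  exact (Measure.absolutelyContinuous_of_le hK).trans
    (Measure.smul_absolutelyContinuous (c := K))

/-- If the support of `φ` avoids the boundary, then `φ` cut off to `Ω` is still `C¹` with compact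
support, and its derivatives integrate to zero. -/
lemma isBoundaryMeasureOn_zero {Ω : Set Space} (hΩ : IsOpen Ω) :
    IsBoundaryMeasureOn Ω (frontier Ω)ᶜ 0 := by
  refine ⟨inferInstance, ⟨0, Measure.zero_le _⟩, fun φ hφ hc hs j => ?_⟩
  have hfr : ∀ x ∈ frontier Ω, x ∉ tsupport φ := fun x hx hxs => hs hxs hx
  set g : Space → ℝ := Ω.indicator φ with hg
  have hgs : tsupport g ⊆ tsupport φ := closure_mono (by
    rw [hg, Set.support_indicator]; exact Set.inter_subset_right)
  have hin : ∀ x ∈ Ω, g =ᶠ[𝓝 x] φ := fun x hx => by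
    filter_upwards [hΩ.mem_nhds hx] with y hy
    exact Set.indicator_of_mem hy _
  have hout : ∀ x ∉ Ω, x ∉ tsupport g := by
    intro x hx hxs
    refine hfr x ?_ (hgs hxs)
    rw [hΩ.frontier_eq]
    exact ⟨closure_mono (by rw [hg, Set.support_indicator]; exact Set.inter_subset_left) hxs, hx⟩
  have hgd : ContDiff ℝ 1 g := contDiff_of_forall_mem_tsupport fun x hx =>
    hφ.contDiffAt.congr_of_eventuallyEq (hin x (not_not.mp fun h => hout x h hx))
  have hgc : HasCompactSupport g := hc.mono' (subset_closure.trans hgs)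
  rw [integral_zero_measure, ← integral_fderiv_apply_eq_zero hgd hgc (EuclideanSpace.single j 1),
    ← integral_indicator hΩ.measurableSet]
  congr 1
  funext x
  by_cases hx : x ∈ Ω
  · rw [Set.indicator_of_mem hx, (hin x hx).fderiv_eq]
    rfl
  · rw [Set.indicator_of_notMem hx, fderiv_eq_zero_of_notMem_tsupport (hout x hx)]
    rfl

/-- Choose an axis `k` and a sign `s` with `s ∂ₖρ > 0`, so that the boundary is a graph over the
other coordinates. Any `∂ⱼφ` is traded for a derivative along `e = s eₖ` by a tangential field, and
the latter is integrated line by line. The resulting measure is Lebesgue measure of the base carried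
to the graph, with the area density `|∇ρ| / (s ∂ₖρ)`. -/
lemma exists_isBoundaryMeasureOn_nhds {Ω : Set Space} (hΩ : IsOpen Ω) {x₀ : Space}
    (hx₀ : x₀ ∈ frontier Ω) {ρ : Space → ℝ} (hρ : IsLocalDefiningFunction Ω x₀ ρ) :
    ∃ U μ, IsOpen U ∧ x₀ ∈ U ∧ volume (frontier Ω ∩ U) = 0 ∧ IsBoundaryMeasureOn Ω U μ := by
  obtain ⟨k, hk⟩ : ∃ k, gradient ρ x₀ k ≠ 0 := by
    by_contra! hh
    exact hρ.2.1 (by ext i; simpa using hh i)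
  obtain ⟨s, hs, hspos⟩ : ∃ s : ℝ, s * s = 1 ∧ 0 < s * gradient ρ x₀ k := by
    rcases lt_or_gt_of_ne hk with h | h
    · exact ⟨-1, by norm_num, by linarith⟩
    · exact ⟨1, by norm_num, by linarith⟩
  set e : Space := s • EuclideanSpace.single k (1 : ℝ) with he
  have hρe : ∀ x, fderiv ℝ ρ x e = s * gradient ρ x k := fun x => by
    rw [he, map_smul, gradient_apply, smul_eq_mul]
  -- The added `1` makes the bound on the density strict at `x₀`, so it persists nearby.
  set C : ℝ := ‖gradient ρ x₀‖ / (s * gradient ρ x₀ k) + 1 with hC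
  have hCpos : 0 < C := by positivity
  have hcont : ContinuousAt (fun x => s * gradient ρ x k) x₀ := by
    have := continuousAt_gradient hρ.1
    fun_prop
  have hev : ∀ᶠ x in 𝓝 x₀, IsLocalDefiningFunction Ω x ρ ∧ 0 < s * gradient ρ x k ∧
      ‖gradient ρ x‖ < C * (s * gradient ρ x k) := by
    refine hρ.eventually.and ((hcont.eventually (lt_mem_nhds hspos)).and ?_)
    refine (continuousAt_gradient hρ.1).norm.eventually_lt (hcont.const_mul C) ?_
    rw [hC, add_mul, div_mul_cancel₀ _ hspos.ne']
    linarith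
  obtain ⟨W, hW, hWo, hxW⟩ := eventually_nhds_iff.mp hev
  have hρ1 : ∀ x ∈ W, ContDiffAt ℝ 1 ρ x := fun x hx => (hW x hx).1.1.of_le (by norm_num)
  obtain ⟨a, b, V, h, hV, hVfin, hhm, hxU, hgr⟩ := exists_graph_patch hΩ hWo hρ1
    (fun x hx => (hW x hx).1.2.2.self_of_nhds) (fun x hx hf => (hW x hx).1.eq_zero hΩ hf) k s hs
    (fun x hx => by rw [hρe]; exact (hW x hx).2.1) hxW (hρ.eq_zero hΩ hx₀)
  set U := slicing k s hs '' (Set.Ioo a b ×ˢ V) with hU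
  have hUo : IsOpen U := (slicing k s hs).isOpenMap _ (isOpen_Ioo.prod hV)
  have hUW : U ⊆ W := by
    rintro _ ⟨⟨t, y⟩, ⟨ht, hy⟩, rfl⟩
    exact ((hgr y hy).2 t (Set.Ioo_subset_Icc_self ht)).1
  set γ : EuclideanSpace ℝ (Fin 2) → Space := fun y => slicing k s hs (h y, y) with hγ
  have hγm : Measurable γ :=
    (slicing k s hs).continuous.measurable.comp (hhm.prodMk measurable_id)
  have hγmem : ∀ y ∈ V, γ y ∈ frontier Ω ∩ U := fun y hy =>
    ⟨((hgr y hy).2 _ (Set.Ioo_subset_Icc_self (hgr y hy).1)).2.2.mpr rfl,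
      ⟨_, ⟨(hgr y hy).1, hy⟩, rfl⟩⟩
  set μ₀ : Measure Space := (volume.restrict V).map γ with hμ₀
  have hfin : IsFiniteMeasure μ₀ := by
    have : IsFiniteMeasure (volume.restrict V) := ⟨by
      rw [Measure.restrict_apply_univ]; exact hVfin.lt_top⟩
    exact Measure.isFiniteMeasure_map _ γ
  have hμ₀σ : μ₀ ≤ surfaceMeasure Ω :=
    map_graph_le_surfaceMeasure k s hs hhm fun y hy => (hγmem y hy).1
  classical
  -- The density is set to `0` off `W`, where the quotient is not controlled; this makes it globally
  -- measurable and bounded by `C`.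
  set D : Space → NNReal :=
    fun x => Real.toNNReal (W.piecewise (fun x => ‖gradient ρ x‖ / (s * gradient ρ x k)) 0 x)
    with hD
  have hDm : Measurable D := by
    refine (ContinuousOn.measurable_piecewise ?_ continuous_const.continuousOn
      hWo.measurableSet).real_toNNReal
    intro x hx
    have hc := continuousAt_gradient (hW x hx).1.1
    have hne := (hW x hx).2.1.ne'
    refine ContinuousAt.continuousWithinAt ?_
    fun_prop (disch := exact hne)
  have hDW : ∀ x ∈ W, (D x : ℝ) = ‖gradient ρ x‖ / (s * gradient ρ x k) := fun x hx => by
    have := (hW x hx).2.1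
    rw [hD]
    simp only [Set.piecewise_eq_of_mem _ _ _ hx]
    exact Real.coe_toNNReal _ (by positivity)
  have hDC : ∀ x, D x ≤ C.toNNReal := fun x => by
    refine Real.toNNReal_le_toNNReal ?_
    by_cases hx : x ∈ W
    · rw [Set.piecewise_eq_of_mem _ _ _ hx, div_le_iff₀ (hW x hx).2.1]
      exact (hW x hx).2.2.le
    · rw [Set.piecewise_eq_of_notMem _ _ _ hx]
      exact hCpos.le
  have hle : μ₀.withDensity (fun x => (D x : ENNReal)) ≤ C.toNNReal • μ₀ := by
    refine (withDensity_mono (g := fun _ => (C.toNNReal : ENNReal))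
      (ae_of_all _ fun x => ENNReal.coe_le_coe.mpr (hDC x))).trans ?_
    rw [withDensity_const]
    exact le_rfl
  refine ⟨U, μ₀.withDensity fun x => (D x : ENNReal), hUo, hxU, ?_, ?_, ?_, ?_⟩
  · exact volume_graph_patch_eq_zero isClosed_frontier k s hs hV fun y hy t ht =>
      ((hgr y hy).2 t (Set.Ioo_subset_Icc_self ht)).2.2.mp
  · exact isFiniteMeasure_of_le _ hle
  · exact ⟨C.toNNReal, hle.trans (by gcongr)⟩
  · intro φ hφ hφc hφU j
    -- This factor makes `φ eⱼ - w e` tangential to the level sets of `ρ`. It is `C¹` because `ρ` is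
    -- `C²`, and on the boundary it equals `D φ νⱼ`.
    set w : Space → ℝ := fun x => gradient ρ x j / (s * gradient ρ x k) * φ x with hw
    have hws : tsupport w ⊆ tsupport φ := closure_mono (Function.support_mul_subset_right _ _)
    have hwd : ContDiff ℝ 1 w := contDiff_of_forall_mem_tsupport fun x hx => by
      have hxW := hUW (hφU (hws hx))
      have h2 : ∀ i, ContDiffAt ℝ 1 (fun x => gradient ρ x i) x := fun i => by
        simp_rw [gradient_apply]
        exact ((hW x hxW).1.1.fderiv_right (m := 1) (by norm_num)).clm_apply contDiffAt_const
      exact ((h2 j).div (contDiffAt_const.mul (h2 k)) (hW x hxW).2.1.ne').mul hφ.contDiffAt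
    have hwc : HasCompactSupport w := hφc.mul_left
    have e1 : ∫ x in Ω, classicalPartial j φ x = ∫ x in Ω, fderiv ℝ w x e :=
      setIntegral_fderiv_eq_of_tangential hΩ hρ1
        (fun x hx => (hW x hx).1.2.2.self_of_nhds) hφ hφc (hφU.trans hUW) hwd hwc
        (hws.trans (hφU.trans hUW)) _ _ fun x hx => by
          have := (hW x hx).2.1.ne'
          rw [← gradient_apply, hρe, hw]
          simp only
          rw [div_mul_eq_mul_div, div_mul_cancel₀ _ this, mul_comm]
    rw [e1, setIntegral_fderiv_eq_graph hΩ k s hs hV (fun y hy => ⟨(hgr y hy).1, fun t ht =>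
      ((hgr y hy).2 t ht).2.1⟩) hwd hwc (hws.trans hφU),
      integral_withDensity_eq_integral_smul hDm,
      ← integral_map (φ := γ) (f := w) hγm.aemeasurable hwd.continuous.aestronglyMeasurable]
    refine integral_congr_ae ?_
    have hae : ∀ᵐ x ∂μ₀, x ∈ frontier Ω ∩ U :=
      (ae_map_iff hγm.aemeasurable
        (isClosed_frontier.measurableSet.inter hUo.measurableSet)).mpr
        ((ae_restrict_mem hV.measurableSet).mono hγmem)
    filter_upwards [hae] with x hx
    have hxW := hUW hx.2
    have hg0 : ‖gradient ρ x‖ ≠ 0 := norm_ne_zero_iff.mpr (hW x hxW).1.2.1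
    have hne := (hW x hxW).2.1.ne'
    rw [outwardNormal_eq hΩ hx.1 (hW x hxW).1, NNReal.smul_def, hDW x hxW, hw]
    simp only [PiLp.smul_apply, smul_eq_mul]
    field_simp

lemma IsBoundaryMeasureOn.integrable_mul_outwardNormal {Ω : BoundedC2Domain} {U : Set Space}
    {μ : Measure Space} (h : IsBoundaryMeasureOn Ω.carrier U μ) {φ : Space → ℝ}
    (hφ : Continuous φ) (hc : HasCompactSupport φ) (j : Fin 3) :
    Integrable (fun x => φ x * outwardNormal Ω.carrier x j) μ := by
  have := h.isFinite
  obtain ⟨C, hC⟩ := hc.exists_bound_of_continuous hφ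
  have hm : AEStronglyMeasurable (fun x => outwardNormal Ω.carrier x j) μ :=
    (EuclideanSpace.proj (𝕜 := ℝ) j : Space →L[ℝ] ℝ).continuous.comp_aestronglyMeasurable
      ((aestronglyMeasurable_outwardNormal Ω).mono_ac h.absolutelyContinuous)
  refine Integrable.of_bound (hφ.aestronglyMeasurable.mul hm) C ?_
  filter_upwards [h.absolutelyContinuous.ae_le (ae_norm_outwardNormal Ω)] with x hx
  rw [norm_mul]
  have h1 : ‖outwardNormal Ω.carrier x j‖ ≤ 1 := (PiLp.norm_apply_le _ j).trans hx.le
  exact (mul_le_of_le_one_right (norm_nonneg _) h1).trans (hC x)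

open scoped Manifold in
-- Weight each `μ i` by the function `f i` of a subordinate partition of unity. The local theorem
-- applied to `f i * φ`, summed over `i`, is the global one, and the domination constants add up.
lemma exists_isBoundaryMeasureOn_univ_of_cover (Ω : BoundedC2Domain) {ι : Type} [Fintype ι]
    (U : ι → Set Space) (μ : ι → Measure Space) (hU : ∀ i, IsOpen (U i))
    (hcov : ⋃ i, U i = Set.univ) (hμ : ∀ i, IsBoundaryMeasureOn Ω.carrier (U i) (μ i)) :
    ∃ μ, IsBoundaryMeasureOn Ω.carrier Set.univ μ := by
  obtain ⟨f, hf⟩ := SmoothPartitionOfUnity.exists_isSubordinate 𝓘(ℝ, Space)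
    (s := (Set.univ : Set Space)) isClosed_univ U hU hcov.ge
  have hfd : ∀ i, ContDiff ℝ ∞ (f i) := fun i => (f i).contMDiff.contDiff
  have hf1 : ∀ x, ∑ i, f i x = 1 := fun x => by
    rw [← finsum_eq_sum_of_fintype]
    exact f.sum_eq_one (Set.mem_univ x)
  set d : ι → Space → NNReal := fun i x => (f i x).toNNReal with hd
  have hdm : ∀ i, Measurable (d i) := fun i => (hfd i).continuous.measurable.real_toNNReal
  have hle : ∀ i, (μ i).withDensity (fun x => (d i x : ENNReal)) ≤ μ i := fun i => by
    refine (withDensity_mono (g := 1) (ae_of_all _ fun x => ?_)).trans ?_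
    · rw [Pi.one_apply, ENNReal.coe_le_one_iff, hd]
      exact Real.toNNReal_le_one.mpr (f.le_one i x)
    · rw [withDensity_one]
  have hfin := fun i => (hμ i).isFinite
  choose K hK using fun i => (hμ i).exists_le
  refine ⟨∑ i, (μ i).withDensity (fun x => (d i x : ENNReal)), ?_, ⟨∑ i, K i, ?_⟩, ?_⟩
  · have := fun i => isFiniteMeasure_of_le _ (hle i)
    infer_instance
  · rw [Finset.sum_smul]
    exact Finset.sum_le_sum fun i _ => (hle i).trans (hK i)
  · intro φ hφ hc _ j
    have hφi : ∀ i, ContDiff ℝ 1 (fun x => f i x * φ x) := fun i =>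
      ((hfd i).of_le (by simp)).mul hφ
    have hci : ∀ i, HasCompactSupport (fun x => f i x * φ x) := fun i => hc.mul_left
    have hsum : φ = fun x => ∑ i, f i x * φ x := by
      funext x
      rw [← Finset.sum_mul, hf1, one_mul]
    have hder : ∀ x, classicalPartial j φ x
        = ∑ i, classicalPartial j (fun x => f i x * φ x) x := fun x => by
      conv_lhs => rw [hsum]
      simp only [classicalPartial]
      rw [fderiv_fun_sum fun i _ => (hφi i).differentiable (by simp) x,
        _root_.sum_apply]
    have hint : ∀ i, Integrable (fun x => φ x * outwardNormal Ω.carrier x j) (μ i) := fun i =>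
      (hμ i).integrable_mul_outwardNormal hφ.continuous hc j
    simp_rw [hder]
    have hinΩ : ∀ i, IntegrableOn (classicalPartial j fun x => f i x * φ x) Ω.carrier := fun i =>
      (integrable_fderiv_apply (hφi i) (hci i) (EuclideanSpace.single j 1)).integrableOn
    rw [integral_finsetSum _ fun i _ => hinΩ i,
      integral_finsetSum_measure fun i _ => (hint i).mono_measure (hle i)]
    refine Finset.sum_congr rfl fun i _ => ?_
    rw [(hμ i).integral_eq _ (hφi i) (hci i)
      ((closure_mono (Function.support_mul_subset_left _ _)).trans (hf i)) j,
      integral_withDensity_eq_integral_smul (hdm i)]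
    refine integral_congr_ae (ae_of_all _ fun x => ?_)
    simp only [NNReal.smul_def, hd, Real.coe_toNNReal _ (f.nonneg i x), smul_eq_mul, mul_assoc]

/-- The boundary of a `C²` domain is a null set, and the divergence theorem holds with respect to
some measure that is dominated by a multiple of the surface measure. -/
theorem exists_isBoundaryMeasureOn_univ (Ω : BoundedC2Domain) :
    volume (frontier Ω.carrier) = 0 ∧ ∃ μ, IsBoundaryMeasureOn Ω.carrier Set.univ μ := by
  have hloc : ∀ x : frontier Ω.carrier, ∃ U μ, IsOpen U ∧ x.1 ∈ U ∧
      volume (frontier Ω.carrier ∩ U) = 0 ∧ IsBoundaryMeasureOn Ω.carrier U μ := fun x => by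
    obtain ⟨ρ, hρ⟩ := Ω.boundary_c2 x x.2
    exact exists_isBoundaryMeasureOn_nhds Ω.isOpen x.2 hρ
  choose U μ hUo hxU hnull hμ using hloc
  have hcomp : IsCompact (frontier Ω.carrier) :=
    Metric.isCompact_of_isClosed_isBounded isClosed_frontier
      (Ω.isBounded.closure.subset frontier_subset_closure)
  obtain ⟨t, ht⟩ := hcomp.elim_finite_subcover U hUo fun x hx =>
    Set.mem_iUnion.mpr ⟨⟨x, hx⟩, hxU _⟩
  constructor
  · refine measure_mono_null (t := ⋃ i ∈ t, frontier Ω.carrier ∩ U i) (fun x hx => ?_)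
      ((measure_biUnion_null_iff t.countable_toSet).mpr fun i _ => hnull i)
    obtain ⟨i, hi, hxi⟩ := Set.mem_iUnion₂.mp (ht hx)
    exact Set.mem_iUnion₂.mpr ⟨i, hi, hx, hxi⟩
  -- The index `none` stands for the complement of the boundary, with the zero measure; compactness
  -- makes the remaining patches finite in number.
  · refine exists_isBoundaryMeasureOn_univ_of_cover Ω (ι := Option t)
      (fun i => i.elim (frontier Ω.carrier)ᶜ fun i => U i) (fun i => i.elim 0 fun i => μ i) ?_ ?_ ?_
    · rintro (_ | i)
      · exact isClosed_frontier.isOpen_compl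
      · exact hUo i
    · refine Set.eq_univ_of_forall fun x => Set.mem_iUnion.mpr ?_
      by_cases hx : x ∈ frontier Ω.carrier
      · obtain ⟨i, hi, hxi⟩ := Set.mem_iUnion₂.mp (ht hx)
        exact ⟨some ⟨i, hi⟩, hxi⟩
      · exact ⟨none, hx⟩
    · rintro (_ | i)
      · exact isBoundaryMeasureOn_zero Ω.isOpen
      · exact hμ i

/-! ### The exterior domain -/

lemma isOpen_exterior (Ω : Set Space) : IsOpen (exterior Ω) := isClosed_closure.isOpen_compl

lemma ae_mem_or_mem_exterior (Ω : BoundedC2Domain) :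
    ∀ᵐ x : Space, x ∈ Ω.carrier ∨ x ∈ exterior Ω.carrier := by
  filter_upwards [measure_eq_zero_iff_ae_notMem.mp (exists_isBoundaryMeasureOn_univ Ω).1] with x hx
  rw [Ω.isOpen.frontier_eq] at hx
  by_cases h : x ∈ Ω.carrier
  · exact Or.inl h
  · exact Or.inr fun hc => hx ⟨hc, h⟩

lemma disjoint_exterior (Ω : Set Space) : Disjoint Ω (exterior Ω) :=
  Set.disjoint_left.mpr fun _ hx hx' => hx' (subset_closure hx)

lemma setIntegral_add_exterior (Ω : BoundedC2Domain) {f : Space → ℝ} (hf : Integrable f) :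
    (∫ x in Ω.carrier, f x) + (∫ x in exterior Ω.carrier, f x) = ∫ x, f x := by
  rw [← setIntegral_union (disjoint_exterior _) (isOpen_exterior _).measurableSet hf.integrableOn
    hf.integrableOn, ← setIntegral_univ (μ := volume)]
  refine setIntegral_congr_set ?_
  filter_upwards [ae_mem_or_mem_exterior Ω] with x hx
  exact propext ⟨fun _ => trivial, fun _ => hx⟩

/-- The boundary is null and the integral over all of space vanishes, so the exterior integral is
the negative of the interior one. No patching on the exterior side is needed. -/
lemma IsBoundaryMeasureOn.integral_exterior_eq {Ω : BoundedC2Domain} {μ : Measure Space}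
    (h : IsBoundaryMeasureOn Ω.carrier Set.univ μ) {φ : Space → ℝ} (hφ : ContDiff ℝ 1 φ)
    (hc : HasCompactSupport φ) (j : Fin 3) :
    ∫ x in exterior Ω.carrier, classicalPartial j φ x
      = -∫ x, φ x * outwardNormal Ω.carrier x j ∂μ := by
  have h1 := setIntegral_add_exterior Ω (integrable_fderiv_apply hφ hc (EuclideanSpace.single j 1))
  rw [integral_fderiv_apply_eq_zero hφ hc] at h1
  have h2 := h.integral_eq φ hφ hc (Set.subset_univ _) j
  rw [← h2]
  exact eq_neg_of_add_eq_zero_right h1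

/-! ### Symmetry of the Dirac matrices -/

lemma diracAlpha_isHermitian (j : Fin 3) : (diracAlpha j).IsHermitian := by
  refine Matrix.IsHermitian.ext fun a b => ?_
  fin_cases j <;> fin_cases a <;> fin_cases b <;>
    simp [diracAlpha, pauli, blockEquiv, finSumFinEquiv, Fin.addCases]

lemma diracBeta_isHermitian : diracBeta.IsHermitian := by
  refine Matrix.IsHermitian.ext fun a b => ?_
  fin_cases a <;> fin_cases b <;>
    simp [diracBeta, blockEquiv, finSumFinEquiv, Fin.addCases]

lemma inner_act_left {M : Matrix (Fin 4) (Fin 4) ℂ} (hM : M.IsHermitian) (u v : Spinor) :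
    inner ℂ (act M u) v = inner ℂ u (act M v) := by
  have h : ContinuousLinearMap.adjoint (act M) = act M := by
    rw [← ContinuousLinearMap.star_eq_adjoint, act, ← map_star]
    exact congrArg _ hM.eq
  exact (ContinuousLinearMap.adjoint_inner_right (𝕜 := ℂ) (act M) u v).symm.trans (by rw [h])

lemma im_inner_act_self {M : Matrix (Fin 4) (Fin 4) ℂ} (hM : M.IsHermitian) (u : Spinor) :
    (inner ℂ u (act M u)).im = 0 := by
  have h := inner_conj_symm (𝕜 := ℂ) u (act M u)
  rw [inner_act_left hM] at h
  exact Complex.conj_eq_iff_im.mp h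

lemma re_inner_act_comm {M : Matrix (Fin 4) (Fin 4) ℂ} (hM : M.IsHermitian) (u v : Spinor) :
    (inner ℂ u (act M v)).re = (inner ℂ v (act M u)).re := by
  rw [← inner_act_left hM, ← inner_conj_symm, Complex.conj_re]

lemma act_alphaDot (x : Space) (u : Spinor) :
    act (alphaDot x) u = ∑ j, ((x j : ℝ) : ℂ) • act (diracAlpha j) u := by
  simp only [alphaDot, act, map_sum, map_smul, _root_.sum_apply, _root_.smul_apply]

lemma alphaDot_isHermitian (x : Space) : (alphaDot x).IsHermitian := by
  simp only [Matrix.IsHermitian, alphaDot, Matrix.conjTranspose_sum, Matrix.conjTranspose_smul,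
    (diracAlpha_isHermitian _).eq]
  simp

/-- The coupling condition forces the normal current to be continuous across the shell. -/
lemma re_inner_alphaDot_eq_of_coupling {c η τ : ℝ} (hc : c ≠ 0) {ν : Space} {p q : Spinor}
    (h : (Complex.I * (c : ℂ)) • act (alphaDot ν) (p - q)
      + (1 / 2 : ℂ) • act ((η : ℂ) • (1 : Matrix (Fin 4) (Fin 4) ℂ) + (τ : ℂ) • diracBeta)
          (p + q) = 0) :
    (inner ℂ p (act (alphaDot ν) p)).re = (inner ℂ q (act (alphaDot ν) q)).re := by
  have hM : ((η : ℂ) • (1 : Matrix (Fin 4) (Fin 4) ℂ) + (τ : ℂ) • diracBeta).IsHermitian := by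
    simp [Matrix.IsHermitian, diracBeta_isHermitian.eq]
  -- Paired with `p + q`, the hermitian matrix `η + τ β` contributes a real number. Imaginary parts
  -- leave `Re ⟨p + q, (α·ν)(p - q)⟩ = 0`, whose cross terms cancel because `α·ν` is hermitian.
  have h1 := congrArg (fun v => (inner ℂ (p + q) v).im) h
  simp only [inner_add_right, inner_smul_right, inner_zero_right, Complex.add_im] at h1
  have h2 : ∀ w : ℂ, ((1 / 2 : ℂ) * w).im = 1 / 2 * w.im := fun w => by
    simp [Complex.mul_im]
  have h3 : ∀ w : ℂ, (Complex.I * (c : ℂ) * w).im = c * w.re := fun w => by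
    simp [Complex.mul_im]
  rw [h2, im_inner_act_self hM, h3] at h1
  simp only [Complex.zero_im, mul_zero, add_zero, mul_eq_zero, hc, false_or, map_sub,
    inner_sub_right, inner_add_left, Complex.sub_re, Complex.add_re] at h1
  have h4 := re_inner_act_comm (alphaDot_isHermitian ν) p q
  linarith

/-! ### Limits of pairings -/

lemma tendsto_integral_re_inner {μ : Measure Space} {u v : ℕ → Space → Spinor}
    {f g : Space → Spinor} (hu : ∀ n, MemLp (u n) 2 μ) (hv : ∀ n, MemLp (v n) 2 μ)
    (hf : MemLp f 2 μ) (hg : MemLp g 2 μ)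
    (huf : Tendsto (fun n => eLpNorm (u n - f) 2 μ) atTop (𝓝 0))
    (hvg : Tendsto (fun n => eLpNorm (v n - g) 2 μ) atTop (𝓝 0)) :
    Tendsto (fun n => ∫ x, (inner ℂ (u n x) (v n x)).re ∂μ) atTop
      (𝓝 (∫ x, (inner ℂ (f x) (g x)).re ∂μ)) := by
  have h1 := (Lp.tendsto_Lp_iff_tendsto_eLpNorm'' u hu f hf).mpr huf
  have h2 := (Lp.tendsto_Lp_iff_tendsto_eLpNorm'' v hv g hg).mpr hvg
  have key : ∀ {f g : Space → Spinor} (hf : MemLp f 2 μ) (hg : MemLp g 2 μ),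
      (inner ℂ (hf.toLp f) (hg.toLp g)).re = ∫ x, (inner ℂ (f x) (g x)).re ∂μ := by
    intro f g hf hg
    have hi : Integrable (fun x => inner ℂ (hf.toLp f x) (hg.toLp g x)) μ :=
      L2.integrable_inner (𝕜 := ℂ) _ _
    rw [L2.inner_def]
    have := integral_re (𝕜 := ℂ) hi
    refine this.symm.trans (integral_congr_ae ?_)
    filter_upwards [hf.coeFn_toLp, hg.coeFn_toLp] with x hx hx'
    rw [hx, hx']
    rfl
  have h3 := (Complex.continuous_re.tendsto _).comp (h1.inner (𝕜 := ℂ) h2)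
  simpa only [Function.comp_def, key] using h3

lemma integrable_re_inner {μ : Measure Space} {f g : Space → Spinor} (hf : MemLp f 2 μ)
    (hg : MemLp g 2 μ) : Integrable (fun x => (inner ℂ (f x) (g x)).re) μ := by
  have hi : Integrable (fun x => inner ℂ (hf.toLp f x) (hg.toLp g x)) μ :=
    L2.integrable_inner (𝕜 := ℂ) _ _
  refine (hi.re).congr ?_
  filter_upwards [hf.coeFn_toLp, hg.coeFn_toLp] with x hx hx'
  rw [hx, hx']
  rfl

lemma tendsto_eLpNorm_bounded_smul_comp {μ : Measure Space} {u : ℕ → Space → Spinor}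
    {f : Space → Spinor} (b : Space → ℝ) (hb : ∀ᵐ x ∂μ, ‖b x‖ ≤ 1)
    (A : Spinor →L[ℝ] Spinor)
    (h : Tendsto (fun n => eLpNorm (u n - f) 2 μ) atTop (𝓝 0)) :
    Tendsto (fun n => eLpNorm ((fun x => b x • A (u n x)) - fun x => b x • A (f x)) 2 μ) atTop
      (𝓝 0) := by
  have hs := ENNReal.Tendsto.const_mul (a := ENNReal.ofReal ‖A‖) h (Or.inr ENNReal.ofReal_ne_top)
  rw [mul_zero] at hs
  refine tendsto_of_tendsto_of_tendsto_of_le_of_le tendsto_const_nhds hs (fun _ => zero_le)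
    fun n => ?_
  refine eLpNorm_le_mul_eLpNorm_of_ae_le_mul ?_ 2
  filter_upwards [hb] with x hx
  simp only [Pi.sub_apply]
  rw [← smul_sub, ← map_sub, norm_smul]
  exact (mul_le_of_le_one_left (norm_nonneg _) hx).trans (A.le_opNorm _)

lemma memLp_bounded_smul_comp {μ : Measure Space} {f : Space → Spinor} {b : Space → ℝ}
    (hbm : AEStronglyMeasurable b μ) (hb : ∀ᵐ x ∂μ, ‖b x‖ ≤ 1)
    (A : Spinor →L[ℝ] Spinor) (hf : MemLp f 2 μ) : MemLp (fun x => b x • A (f x)) 2 μ := by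
  refine (A.comp_memLp' hf).of_le
    (hbm.smul (A.continuous.comp_aestronglyMeasurable hf.1)) ?_
  filter_upwards [hb] with x hx
  rw [norm_smul]
  exact mul_le_of_le_one_left (norm_nonneg _) hx

/-! ### Green's formula -/

lemma contDiff_re_inner_act {φ : Space → Spinor} (hφ : ContDiff ℝ ∞ φ)
    (M : Matrix (Fin 4) (Fin 4) ℂ) :
    ContDiff ℝ 1 fun x => (inner ℂ (φ x) (act M (φ x))).re := by
  have h1 : ContDiff ℝ 1 φ := hφ.of_le (by simp)
  have h2 : ContDiff ℝ 1 fun x => act M (φ x) :=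
    ((act M).restrictScalars ℝ).contDiff.comp h1
  exact Complex.reCLM.contDiff.comp (h1.inner ℂ h2)

lemma classicalPartial_re_inner_act {φ : Space → Spinor} (hφ : ContDiff ℝ ∞ φ)
    {M : Matrix (Fin 4) (Fin 4) ℂ} (hM : M.IsHermitian) (j : Fin 3) (x : Space) :
    classicalPartial j (fun x => (inner ℂ (φ x) (act M (φ x))).re) x
      = 2 * (inner ℂ (φ x) (act M (classicalPartial j φ x))).re := by
  have h1 : HasFDerivAt φ (fderiv ℝ φ x) x := (hφ.differentiable (by simp) x).hasFDerivAt
  have h2 : HasFDerivAt (fun x => act M (φ x)) (((act M).restrictScalars ℝ).comp (fderiv ℝ φ x)) x :=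
    ((act M).restrictScalars ℝ).hasFDerivAt.comp x h1
  have h3 := Complex.reCLM.hasFDerivAt.comp x (h1.inner ℂ h2)
  have h4 : classicalPartial j (fun x => (inner ℂ (φ x) (act M (φ x))).re) x
      = (inner ℂ (φ x) (act M (classicalPartial j φ x))
          + inner ℂ (classicalPartial j φ x) (act M (φ x))).re := by
    rw [classicalPartial]
    erw [h3.fderiv]
    rfl
  rw [h4, Complex.add_re, re_inner_act_comm hM (classicalPartial j φ x)]
  ring

/-- Green's formula for `H¹` functions and their traces, deduced from the divergence theorem for
smooth functions. -/
lemma integral_re_inner_weakPartial {Ω : BoundedC2Domain} {O : Set Space} {μ : Measure Space}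
    (hμ : IsBoundaryMeasureOn Ω.carrier Set.univ μ) (ε : ℝ)
    (hO : ∀ φ : Space → ℝ, ContDiff ℝ 1 φ → HasCompactSupport φ → ∀ j,
      ∫ x in O, classicalPartial j φ x = ε * ∫ x, φ x * outwardNormal Ω.carrier x j ∂μ)
    {f g : Space → Spinor} (hf : MemH1 O f) (hg : IsTrace O (surfaceMeasure Ω.carrier) f g)
    (j : Fin 3) :
    2 * ∫ x in O, (inner ℂ (f x) (act (diracAlpha j) (weakPartial O j f x))).re
      = ε * ∫ x, (inner ℂ (g x) (outwardNormal Ω.carrier x j • act (diracAlpha j) (g x))).re ∂μ := by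
  have := hμ.isFinite
  set A : Spinor →L[ℝ] Spinor := (act (diracAlpha j)).restrictScalars ℝ with hA
  obtain ⟨K, hK⟩ := hμ.exists_le
  obtain ⟨hgL, φ, hφ, h1, h2, h3⟩ := hg
  have hgμ : MemLp g 2 μ := by
    refine hgL.of_measure_le_smul (c := (K : ENNReal)) ENNReal.coe_ne_top hK
  -- Here `μ ≤ K σ` is used: convergence of the boundary values in `L²(σ)` passes to `L²(μ)`.
  have h3μ : Tendsto (fun n => eLpNorm (φ n - g) 2 μ) atTop (𝓝 0) := by
    have hs := ENNReal.Tendsto.const_mul (a := (K : ENNReal) ^ (1 / (2 : ENNReal)).toReal) h3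
      (Or.inr (ENNReal.rpow_ne_top_of_nonneg (by simp) ENNReal.coe_ne_top))
    rw [mul_zero] at hs
    refine tendsto_of_tendsto_of_tendsto_of_le_of_le tendsto_const_nhds hs (fun _ => zero_le)
      fun n => ?_
    refine (eLpNorm_mono_measure _ hK).trans ?_
    exact (eLpNorm_smul_measure_of_ne_top (p := 2) (by simp) _ (K : ENNReal)).le
  have hν1 : ∀ᵐ x ∂μ, ‖outwardNormal Ω.carrier x j‖ ≤ 1 := by
    filter_upwards [hμ.absolutelyContinuous.ae_le (ae_norm_outwardNormal Ω)] with x hx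
    exact (PiLp.norm_apply_le _ j).trans hx.le
  have hνm : AEStronglyMeasurable (fun x => outwardNormal Ω.carrier x j) μ :=
    (EuclideanSpace.proj (𝕜 := ℝ) j : Space →L[ℝ] ℝ).continuous.comp_aestronglyMeasurable
      ((aestronglyMeasurable_outwardNormal Ω).mono_ac hμ.absolutelyContinuous)
  have hφc : ∀ n, Continuous (φ n) := fun n => (hφ n).1.continuous
  have hφL : ∀ n, MemLp (φ n) 2 (volume.restrict O) := fun n =>
    (hφc n).memLp_of_hasCompactSupport (hφ n).2
  have hφμ : ∀ n, MemLp (φ n) 2 μ := fun n => (hφc n).memLp_of_hasCompactSupport (hφ n).2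
  have hdφL : ∀ n, MemLp (classicalPartial j (φ n)) 2 (volume.restrict O) := fun n =>
    (continuous_classicalPartial j (hφ n).1).memLp_of_hasCompactSupport
      ((hφ n).2.fderiv_apply (𝕜 := ℝ) _)
  have one1 : ∀ᵐ x ∂(volume.restrict O), ‖(1 : ℝ)‖ ≤ 1 := ae_of_all _ fun _ => by simp
  have hL := tendsto_integral_re_inner hφL
    (fun n => memLp_bounded_smul_comp (b := fun _ => 1) aestronglyMeasurable_const one1 A (hdφL n))
    hf.1 (memLp_bounded_smul_comp (b := fun _ => 1) aestronglyMeasurable_const one1 A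
      (hf.2 j).memLp_weakPartial) h1
    (tendsto_eLpNorm_bounded_smul_comp (fun _ => 1) one1 A (h2 j))
  have hR := tendsto_integral_re_inner hφμ
    (fun n => memLp_bounded_smul_comp hνm hν1 A (hφμ n)) hgμ
    (memLp_bounded_smul_comp hνm hν1 A hgμ) h3μ
    (tendsto_eLpNorm_bounded_smul_comp _ hν1 A h3μ)
  simp only [one_smul, hA, ContinuousLinearMap.coe_restrictScalars'] at hL hR
  -- For the smooth approximants both sides agree by the divergence theorem applied to the scalar
  -- function `Re ⟨φₙ, αⱼ φₙ⟩`; uniqueness of limits gives the formula for `f` and `g`.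
  refine tendsto_nhds_unique (hL.const_mul 2) ((hR.const_mul ε).congr fun n => ?_)
  have hd := hO _ (contDiff_re_inner_act (hφ n).1 (diracAlpha j))
    ((hφ n).2.mono fun x hx hx0 => hx (by simp [hx0])) j
  simp_rw [classicalPartial_re_inner_act (hφ n).1 (diracAlpha_isHermitian j)] at hd
  rw [integral_const_mul] at hd
  rw [hd]
  congr 2
  funext x
  rw [inner_smul_right_eq_smul, Complex.smul_re, smul_eq_mul, mul_comm]

/-- This is the symmetry of `A` at the level of quadratic forms: `Re ⟨f, α·∇ f⟩ = 0`. Green's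
formula has opposite signs on the two sides, and the normal currents agree `μ`-a.e. because `μ ≪ σ`.
-/
lemma sum_integral_re_inner_weakPartial_eq_zero {c η τ : ℝ} (hc : c ≠ 0) {Ω : BoundedC2Domain}
    {f : Space → Spinor} (hf : MemDomain c η τ Ω.carrier f) :
    ∑ j, ((∫ x in Ω.carrier,
        (inner ℂ (f x) (act (diracAlpha j) (weakPartial Ω.carrier j f x))).re)
      + ∫ x in exterior Ω.carrier,
        (inner ℂ (f x) (act (diracAlpha j) (weakPartial (exterior Ω.carrier) j f x))).re) = 0 := by
  obtain ⟨μ, hμ⟩ := (exists_isBoundaryMeasureOn_univ Ω).2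
  obtain ⟨hp, hm, gp, gm, tp, tm, hcoup⟩ := hf
  have e1 := fun j => integral_re_inner_weakPartial hμ 1
    (fun φ hφ hφc j => by rw [one_mul]; exact hμ.integral_eq φ hφ hφc (Set.subset_univ _) j) hp tp j
  have e2 := fun j => integral_re_inner_weakPartial hμ (-1)
    (fun φ hφ hφc j => by rw [neg_one_mul]; exact hμ.integral_exterior_eq hφ hφc j) hm tm j
  obtain ⟨K, hK⟩ := hμ.exists_le
  have hi : ∀ {g : Space → Spinor}, MemLp g 2 (surfaceMeasure Ω.carrier) → ∀ j,
      Integrable (fun x => (inner ℂ (g x)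
        (outwardNormal Ω.carrier x j • act (diracAlpha j) (g x))).re) μ := by
    intro g hg j
    have hgμ : MemLp g 2 μ := hg.of_measure_le_smul (c := (K : ENNReal)) ENNReal.coe_ne_top hK
    refine integrable_re_inner hgμ
      (memLp_bounded_smul_comp ?_ ?_ ((act (diracAlpha j)).restrictScalars ℝ) hgμ)
    · exact (EuclideanSpace.proj (𝕜 := ℝ) j : Space →L[ℝ] ℝ).continuous.comp_aestronglyMeasurable
        ((aestronglyMeasurable_outwardNormal Ω).mono_ac hμ.absolutelyContinuous)
    · filter_upwards [hμ.absolutelyContinuous.ae_le (ae_norm_outwardNormal Ω)] with x hx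
      exact (PiLp.norm_apply_le _ j).trans hx.le
  have hsum : ∀ (u : Spinor) (x : Space), ∑ j, (inner ℂ u
      (outwardNormal Ω.carrier x j • act (diracAlpha j) u)).re
        = (inner ℂ u (act (alphaDot (outwardNormal Ω.carrier x)) u)).re := by
    intro u x
    rw [act_alphaDot, inner_sum, Complex.re_sum]
    rfl
  have hbd : ∑ j, ∫ x, (inner ℂ (gp x)
        (outwardNormal Ω.carrier x j • act (diracAlpha j) (gp x))).re ∂μ
      = ∑ j, ∫ x, (inner ℂ (gm x)
        (outwardNormal Ω.carrier x j • act (diracAlpha j) (gm x))).re ∂μ := by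
    rw [← integral_finsetSum _ fun j _ => hi tp.1 j, ← integral_finsetSum _ fun j _ => hi tm.1 j]
    refine integral_congr_ae ?_
    filter_upwards [hμ.absolutelyContinuous.ae_le hcoup] with x hx
    rw [hsum, hsum]
    exact re_inner_alphaDot_eq_of_coupling hc hx
  have h2 : ∑ j, (2 * (∫ x in Ω.carrier,
        (inner ℂ (f x) (act (diracAlpha j) (weakPartial Ω.carrier j f x))).re)
      + 2 * ∫ x in exterior Ω.carrier,
        (inner ℂ (f x) (act (diracAlpha j) (weakPartial (exterior Ω.carrier) j f x))).re) = 0 := by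
    simp_rw [e1, e2, one_mul, neg_one_mul]
    rw [Finset.sum_add_distrib, Finset.sum_neg_distrib, hbd, add_neg_cancel]
  simp_rw [← mul_add, ← Finset.mul_sum] at h2
  linarith

/-- `f` belongs to the domain of `A_{η,τ}` and solves `(A_{η,τ} - z) f = 0`. -/
structure IsEigenfunction (c m η τ : ℝ) (Ω : Set Space) (z : ℂ) (f : Space → Spinor) : Prop where
  memDomain : MemDomain c η τ Ω f
  interior_eq : diracExpr c m Ω f =ᵐ[volume.restrict Ω] z • f
  exterior_eq : diracExpr c m (exterior Ω) f =ᵐ[volume.restrict (exterior Ω)] z • f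

/-! ### Reality of the eigenvalues -/

lemma im_mul_norm_sq_eq {c m : ℝ} {O : Set Space} {f : Space → Spinor} {z : ℂ} {x : Space}
    (h : diracExpr c m O f x = z • f x) :
    z.im * ‖f x‖ ^ 2
      = -c * ∑ j, (inner ℂ (f x) (act (diracAlpha j) (weakPartial O j f x))).re := by
  -- Pair with `f x` and take imaginary parts: the mass term is real, and the factor `-i c` turns
  -- the real part of `⟨f, α·∇ f⟩` into an imaginary part.
  have h1 := congrArg (fun v => (inner ℂ (f x) v).im) h
  have h3 : ∀ w : ℂ, (-Complex.I * (c : ℂ) * w).im = -c * w.re := fun w => by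
    simp [Complex.mul_im]
  have h4 : (z * ((‖f x‖ : ℂ) ^ 2)).im = z.im * ‖f x‖ ^ 2 := by
    rw [← Complex.ofReal_pow, Complex.im_mul_ofReal]
  simp only [diracExpr, inner_add_right, inner_smul_right, inner_sum, Complex.add_im,
    Complex.im_ofReal_mul, im_inner_act_self diracBeta_isHermitian, h3, mul_zero, add_zero,
    inner_self_eq_norm_sq_to_K, Complex.re_sum] at h1
  rw [h1]
  exact h4.symm

/-- The eigenvalues of `A_{η,τ}` are real. -/
theorem IsEigenfunction.im_eq_zero {c m η τ : ℝ} (hc : c ≠ 0) {Ω : BoundedC2Domain} {z : ℂ}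
    {f : Space → Spinor} (hf : IsEigenfunction c m η τ Ω.carrier z f)
    (hL : MemLp f 2 volume) (h0 : ¬ f =ᵐ[volume] 0) : z.im = 0 := by
  have hsq : Integrable (fun x => ‖f x‖ ^ 2) := by
    simpa using hL.integrable_norm_pow (by norm_num)
  have key : ∀ O : Set Space, MemH1 O f → diracExpr c m O f =ᵐ[volume.restrict O] z • f →
      z.im * ∫ x in O, ‖f x‖ ^ 2 = -c * ∑ j, ∫ x in O,
        (inner ℂ (f x) (act (diracAlpha j) (weakPartial O j f x))).re := by
    intro O hO h
    have hi : ∀ j, Integrable (fun x => (inner ℂ (f x) (act (diracAlpha j) (weakPartial O j f x))).re)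
        (volume.restrict O) := fun j => integrable_re_inner hO.1
      ((act (diracAlpha j)).comp_memLp' (hO.2 j).memLp_weakPartial)
    rw [← integral_finsetSum _ fun j _ => hi j, ← integral_const_mul, ← integral_const_mul]
    refine integral_congr_ae ?_
    filter_upwards [h] with x hx
    exact im_mul_norm_sq_eq hx
  have h1 := key _ hf.memDomain.1 hf.interior_eq
  have h2 := key _ hf.memDomain.2.1 hf.exterior_eq
  have h3 := sum_integral_re_inner_weakPartial_eq_zero hc hf.memDomain
  rw [Finset.sum_add_distrib] at h3
  have h4 : z.im * ∫ x, ‖f x‖ ^ 2 = 0 := by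
    rw [← setIntegral_add_exterior Ω hsq, mul_add, h1, h2, ← mul_add, h3, mul_zero]
  refine (mul_eq_zero.mp h4).resolve_right fun h5 => h0 ?_
  rw [integral_eq_zero_iff_of_nonneg (fun x => by positivity) hsq] at h5
  filter_upwards [h5] with x hx
  simpa using hx

/-! ### Pointwise linear maps acting on `H¹` functions and traces -/

/-- Test functions are real valued, so real linearity of `L` suffices. This is what admits the
antilinear time reversal. -/
lemma HasWeakPartial.clm_comp {O : Set Space} {j : Fin 3} {f g k : Space → Spinor}
    (L : Spinor →L[ℝ] Spinor) (hf : MemLp f 2 (volume.restrict O))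
    (hg : MemLp g 2 (volume.restrict O)) (h : HasWeakPartial O j f g)
    (hk : k =ᵐ[volume.restrict O] fun x => L (f x)) :
    HasWeakPartial O j k (fun x => L (g x)) := by
  intro φ hφ hc hs
  have e1 : ∫ x in O, classicalPartial j φ x • k x
      = ∫ x in O, L (classicalPartial j φ x • f x) := by
    refine integral_congr_ae ?_
    filter_upwards [hk] with x hx
    rw [hx, map_smul]
  simp_rw [← map_smul L]
  rw [e1, L.integral_comp_comm (integrable_partial_smul j hφ hc hf),
    L.integral_comp_comm (integrable_test_smul hφ.continuous hc hg), h φ hφ hc hs, map_neg]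

lemma MemH1.clm_comp {O : Set Space} {f k : Space → Spinor} (L : Spinor →L[ℝ] Spinor)
    (h : MemH1 O f) (hk : k =ᵐ[volume.restrict O] fun x => L (f x)) : MemH1 O k :=
  ⟨(memLp_congr_ae hk).mpr (L.comp_memLp' h.1), fun j => ⟨_, L.comp_memLp' (h.2 j).memLp_weakPartial,
    (h.2 j).hasWeakPartial.clm_comp L h.1 (h.2 j).memLp_weakPartial hk⟩⟩

lemma weakPartial_clm_comp {O : Set Space} (hO : IsOpen O) {f k : Space → Spinor}
    (L : Spinor →L[ℝ] Spinor) (h : MemH1 O f) (hk : k =ᵐ[volume.restrict O] fun x => L (f x))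
    (j : Fin 3) : weakPartial O j k =ᵐ[volume.restrict O] fun x => L (weakPartial O j f x) :=
  HasWeakPartial.ae_eq hO ((h.clm_comp L hk).2 j).memLp_weakPartial
    (L.comp_memLp' (h.2 j).memLp_weakPartial) ((h.clm_comp L hk).2 j).hasWeakPartial
    ((h.2 j).hasWeakPartial.clm_comp L h.1 (h.2 j).memLp_weakPartial hk)

lemma tendsto_eLpNorm_clm_comp {μ : Measure Space} {φ : ℕ → Space → Spinor}
    {f k : Space → Spinor} (L : Spinor →L[ℝ] Spinor)
    (h : Tendsto (fun n => eLpNorm (φ n - f) 2 μ) atTop (𝓝 0))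
    (hk : k =ᵐ[μ] fun x => L (f x)) :
    Tendsto (fun n => eLpNorm ((fun x => L (φ n x)) - k) 2 μ) atTop (𝓝 0) := by
  refine (tendsto_eLpNorm_bounded_smul_comp (fun _ => 1) (ae_of_all _ fun _ => by simp) L h).congr
    fun n => eLpNorm_congr_ae ?_
  filter_upwards [hk] with x hx
  simp [hx]

lemma IsTrace.clm_comp {O : Set Space} (hO : IsOpen O) {μ : Measure Space}
    {f k g : Space → Spinor} (L : Spinor →L[ℝ] Spinor) (hf : MemH1 O f)
    (hk : k =ᵐ[volume.restrict O] fun x => L (f x)) (h : IsTrace O μ f g) :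
    IsTrace O μ k (fun x => L (g x)) := by
  obtain ⟨hg, φ, h1, h2, h3, h4⟩ := h
  refine ⟨L.comp_memLp' hg, fun n x => L (φ n x),
    fun n => ⟨L.contDiff.comp (h1 n).1, (h1 n).2.mono fun x hx hx0 => hx (by simp [hx0])⟩,
    tendsto_eLpNorm_clm_comp L h2 hk, fun j => ?_,
    tendsto_eLpNorm_clm_comp L h4 (ae_eq_refl _)⟩
  have e : ∀ n, classicalPartial j (fun x => L (φ n x)) = fun x => L (classicalPartial j (φ n) x) := by
    intro n
    funext x
    have := L.hasFDerivAt.comp x ((h1 n).1.differentiable (by simp) x).hasFDerivAt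
    rw [classicalPartial]
    erw [this.fderiv]
    rfl
  simp_rw [e]
  exact tendsto_eLpNorm_clm_comp L (h3 j) (weakPartial_clm_comp hO L hf hk j)

/-! ### Transport of eigenfunctions -/

/-- The symbol of the Dirac operator, applied to a gradient `w` and a value `v`. -/
noncomputable def diracSymbol (c m : ℝ) (w : Fin 3 → Spinor) (v : Spinor) : Spinor :=
  (-Complex.I * (c : ℂ)) • ∑ j, act (diracAlpha j) (w j)
    + ((m * c ^ 2 : ℝ) : ℂ) • act diracBeta v

/-- The coupling condition for boundary values `p`, `q` at a point with normal `ν`. -/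
def IsCoupled (c η τ : ℝ) (ν : Space) (p q : Spinor) : Prop :=
  (Complex.I * (c : ℂ)) • act (alphaDot ν) (p - q)
    + (1 / 2 : ℂ) • act ((η : ℂ) • (1 : Matrix (Fin 4) (Fin 4) ℂ) + (τ : ℂ) • diracBeta) (p + q) = 0

/-- The eigenvalue equation is algebraic in the gradient and the value at each point, so
intertwining need only be checked on the symbol. -/
lemma diracExpr_clm_comp {c m : ℝ} {O : Set Space} (hO : IsOpen O) {f k : Space → Spinor}
    (L : Spinor →L[ℝ] Spinor) {z z' : ℂ}
    (hL : ∀ w v, diracSymbol c m w v = z • v → diracSymbol c m (fun j => L (w j)) (L v) = z' • L v)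
    (hf : MemH1 O f) (hk : k =ᵐ[volume.restrict O] fun x => L (f x))
    (h : diracExpr c m O f =ᵐ[volume.restrict O] z • f) :
    diracExpr c m O k =ᵐ[volume.restrict O] z' • k := by
  filter_upwards [h, hk, ae_all_iff.mpr fun j => weakPartial_clm_comp hO L hf hk j]
    with x hx hkx hw
  have := hL (fun j => weakPartial O j f x) (f x) hx
  simpa only [diracExpr, diracSymbol, hw, hkx, Pi.smul_apply] using this

/-- Real-linear maps `L₁`, `L₂` of the spinor space that intertwine the differential expressions
and the coupling conditions map eigenfunctions to eigenfunctions. -/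
theorem IsEigenfunction.transport {c m η τ η' τ' : ℝ} {Ω : BoundedC2Domain} {z z' : ℂ}
    {f k : Space → Spinor} (L₁ L₂ : Spinor →L[ℝ] Spinor)
    (hp : ∀ w v, diracSymbol c m w v = z • v →
      diracSymbol c m (fun j => L₁ (w j)) (L₁ v) = z' • L₁ v)
    (hm : ∀ w v, diracSymbol c m w v = z • v →
      diracSymbol c m (fun j => L₂ (w j)) (L₂ v) = z' • L₂ v)
    (hcoup : ∀ ν p q, ‖ν‖ = 1 → IsCoupled c η τ ν p q → IsCoupled c η' τ' ν (L₁ p) (L₂ q))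
    (hkp : k =ᵐ[volume.restrict Ω.carrier] fun x => L₁ (f x))
    (hkm : k =ᵐ[volume.restrict (exterior Ω.carrier)] fun x => L₂ (f x))
    (h : IsEigenfunction c m η τ Ω.carrier z f) : IsEigenfunction c m η' τ' Ω.carrier z' k := by
  obtain ⟨⟨h1, h2, gp, gm, tp, tm, hc⟩, h3, h4⟩ := h
  refine ⟨⟨h1.clm_comp L₁ hkp, h2.clm_comp L₂ hkm, _, _, tp.clm_comp Ω.isOpen L₁ h1 hkp,
    tm.clm_comp (isOpen_exterior _) L₂ h2 hkm, ?_⟩, diracExpr_clm_comp Ω.isOpen L₁ hp h1 hkp h3,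
    diracExpr_clm_comp (isOpen_exterior _) L₂ hm h2 hkm h4⟩
  filter_upwards [hc, ae_norm_outwardNormal Ω] with x hx hν
  exact hcoup _ _ _ hν hx

/-! ### Eigenfunctions and the point spectrum -/

lemma shellExpr_ae_eq_iff {c m : ℝ} {Ω : BoundedC2Domain} {f : Space → Spinor} {z : ℂ} :
    shellExpr c m Ω.carrier f =ᵐ[volume] z • f ↔
      diracExpr c m Ω.carrier f =ᵐ[volume.restrict Ω.carrier] z • f ∧
      diracExpr c m (exterior Ω.carrier) f =ᵐ[volume.restrict (exterior Ω.carrier)] z • f := by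
  have hin : ∀ x ∈ Ω.carrier, shellExpr c m Ω.carrier f x = diracExpr c m Ω.carrier f x := by
    intro x hx
    simp [shellExpr, hx, Set.disjoint_left.mp (disjoint_exterior _) hx]
  have hout : ∀ x ∈ exterior Ω.carrier,
      shellExpr c m Ω.carrier f x = diracExpr c m (exterior Ω.carrier) f x := by
    intro x hx
    simp [shellExpr, hx, Set.disjoint_right.mp (disjoint_exterior _) hx]
  rw [Filter.EventuallyEq, Filter.EventuallyEq, Filter.EventuallyEq,
    ae_restrict_iff' Ω.isOpen.measurableSet, ae_restrict_iff' (isOpen_exterior _).measurableSet]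
  constructor
  · intro h
    constructor
    · filter_upwards [h] with x hx hxΩ
      rw [← hin x hxΩ, hx]
    · filter_upwards [h] with x hx hxΩ
      rw [← hout x hxΩ, hx]
  · rintro ⟨h1, h2⟩
    -- The value `0` of `shellExpr` on the boundary is harmless, since the boundary is null.
    filter_upwards [h1, h2, ae_mem_or_mem_exterior Ω] with x hx1 hx2 hx
    rcases hx with hx | hx
    · rw [hin x hx, hx1 hx]
    · rw [hout x hx, hx2 hx]

lemma isEigenfunction_iff {c m η τ : ℝ} {Ω : BoundedC2Domain} {z : ℂ} {F : HilbertL2} :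
    IsEigenfunction c m η τ Ω.carrier z F ↔
      ∃ h : F ∈ (diracShell c m Ω η τ).domain, diracShell c m Ω η τ ⟨F, h⟩ = z • F := by
  have key : ∀ h : F ∈ (diracShell c m Ω η τ).domain, diracShell c m Ω η τ ⟨F, h⟩ = z • F ↔
      shellExpr c m Ω.carrier F =ᵐ[volume] z • F := by
    intro h
    have e : diracShell c m Ω η τ ⟨F, h⟩
      = (memLp_shellExpr (c := c) (m := m) Ω.isOpen h).toLp (shellExpr c m Ω.carrier F) := rfl
    rw [e, Lp.ext_iff]
    have h1 := (memLp_shellExpr (c := c) (m := m) Ω.isOpen h).coeFn_toLp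
    have h2 := Lp.coeFn_smul z F
    exact ⟨fun hh => h1.symm.trans (hh.trans h2), fun hh => h1.trans (hh.trans h2.symm)⟩
  constructor
  · intro h
    exact ⟨h.1, (key h.1).mpr (shellExpr_ae_eq_iff.mpr ⟨h.2, h.3⟩)⟩
  · rintro ⟨h, hh⟩
    have := shellExpr_ae_eq_iff.mp ((key h).mp hh)
    exact ⟨h, this.1, this.2⟩

lemma mem_pointSpectrum_iff {c m η τ : ℝ} {Ω : BoundedC2Domain} {z : ℂ} :
    z ∈ pointSpectrum (diracShell c m Ω η τ) ↔
      ∃ F : HilbertL2, F ≠ 0 ∧ IsEigenfunction c m η τ Ω.carrier z F := by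
  constructor
  · rintro ⟨f, h0, hf⟩
    exact ⟨f, fun h => h0 (Subtype.ext h), isEigenfunction_iff.mpr ⟨f.2, hf⟩⟩
  · rintro ⟨F, h0, hF⟩
    obtain ⟨h, hh⟩ := isEigenfunction_iff.mp hF
    exact ⟨⟨F, h⟩, fun h1 => h0 (congrArg Subtype.val h1), hh⟩

/-- Eigenvalues are transported by injective intertwining maps. -/
theorem mem_pointSpectrum_of_transport {c m η τ η' τ' : ℝ} {Ω : BoundedC2Domain} {z z' : ℂ}
    (L₁ L₂ : Spinor →L[ℝ] Spinor)
    (hp : ∀ w v, diracSymbol c m w v = z • v →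
      diracSymbol c m (fun j => L₁ (w j)) (L₁ v) = z' • L₁ v)
    (hm : ∀ w v, diracSymbol c m w v = z • v →
      diracSymbol c m (fun j => L₂ (w j)) (L₂ v) = z' • L₂ v)
    (hcoup : ∀ ν p q, ‖ν‖ = 1 → IsCoupled c η τ ν p q → IsCoupled c η' τ' ν (L₁ p) (L₂ q))
    (hp0 : ∀ v, L₁ v = 0 → v = 0) (hm0 : ∀ v, L₂ v = 0 → v = 0)
    (h : z ∈ pointSpectrum (diracShell c m Ω η τ)) :
    z' ∈ pointSpectrum (diracShell c m Ω η' τ') := by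
  classical
  obtain ⟨F, hF0, hF⟩ := mem_pointSpectrum_iff.mp h
  have hΩm := Ω.isOpen.measurableSet
  -- The two images are glued along the boundary; using `L₂` on the boundary itself is immaterial up
  -- to null sets.
  set k : Space → Spinor := Ω.carrier.piecewise (fun x => L₁ (F x)) (fun x => L₂ (F x)) with hk
  have hkL : MemLp k 2 volume :=
    MemLp.piecewise hΩm ((L₁.comp_memLp' (Lp.memLp F)).restrict _)
      ((L₂.comp_memLp' (Lp.memLp F)).restrict _)
  have hK := hkL.coeFn_toLp
  refine mem_pointSpectrum_iff.mpr ⟨hkL.toLp k, fun h0 => hF0 ?_,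
    hF.transport L₁ L₂ hp hm hcoup ?_ ?_⟩
  · rw [Lp.eq_zero_iff_ae_eq_zero] at h0 ⊢
    filter_upwards [h0, hK] with x hx hx'
    rw [hx, hk] at hx'
    by_cases hxΩ : x ∈ Ω.carrier
    · rw [Set.piecewise_eq_of_mem _ _ _ hxΩ] at hx'
      exact hp0 _ hx'.symm
    · rw [Set.piecewise_eq_of_notMem _ _ _ hxΩ] at hx'
      exact hm0 _ hx'.symm
  · filter_upwards [ae_restrict_of_ae hK, ae_restrict_mem hΩm] with x hx hxΩ
    rw [hx, hk, Set.piecewise_eq_of_mem _ _ _ hxΩ]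
  · filter_upwards [ae_restrict_of_ae hK, ae_restrict_mem (isOpen_exterior _).measurableSet]
      with x hx hxΩ
    rw [hx, hk, Set.piecewise_eq_of_notMem _ _ _
      (Set.disjoint_right.mp (disjoint_exterior _) hxΩ)]

/-! ### The Clifford relations -/

lemma act_mul (M N : Matrix (Fin 4) (Fin 4) ℂ) (v : Spinor) : act (M * N) v = act M (act N v) := by
  simp [act, map_mul]

lemma act_one (v : Spinor) : act 1 v = v := by
  simp [act, map_one]

lemma act_neg (M : Matrix (Fin 4) (Fin 4) ℂ) (v : Spinor) : act (-M) v = -act M v := by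
  simp [act, map_neg]

lemma act_shell (η τ : ℝ) (v : Spinor) :
    act ((η : ℂ) • (1 : Matrix (Fin 4) (Fin 4) ℂ) + (τ : ℂ) • diracBeta) v
      = (η : ℂ) • v + (τ : ℂ) • act diracBeta v := by
  simp only [act, map_add, map_smul, map_one]
  rfl

lemma diracAlpha_mul_diracBeta (j : Fin 3) :
    diracAlpha j * diracBeta = -(diracBeta * diracAlpha j) := by
  fin_cases j <;> ext a b <;> fin_cases a <;> fin_cases b <;>
    simp [diracAlpha, diracBeta, pauli, blockEquiv, finSumFinEquiv, Fin.addCases,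
      Matrix.mul_apply, Fin.sum_univ_four]

lemma diracBeta_mul_self : diracBeta * diracBeta = 1 := by
  ext a b
  fin_cases a <;> fin_cases b <;>
    simp [diracBeta, blockEquiv, finSumFinEquiv, Fin.addCases, Matrix.mul_apply, Fin.sum_univ_four]

lemma act_alphaDot_act_alphaDot {ν : Space} (hν : ‖ν‖ = 1) (v : Spinor) :
    act (alphaDot ν) (act (alphaDot ν) v) = v := by
  have h1 : ν 0 ^ 2 + ν 1 ^ 2 + ν 2 ^ 2 = 1 := by
    have := EuclideanSpace.norm_sq_eq ν
    rw [hν, Fin.sum_univ_three] at this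
    simpa using this.symm
  have h2 : (ν 0 : ℂ) ^ 2 + (ν 1 : ℂ) ^ 2 + (ν 2 : ℂ) ^ 2 = 1 := by
    simpa using congrArg Complex.ofReal h1
  rw [← act_mul]
  have : alphaDot ν * alphaDot ν = 1 := by
    ext a b
    fin_cases a <;> fin_cases b <;>
      simp [alphaDot, diracAlpha, pauli, blockEquiv, finSumFinEquiv, Fin.addCases,
        Matrix.mul_apply, Fin.sum_univ_four, Fin.sum_univ_three] <;>
      ring_nf <;> simp only [Complex.I_sq] <;> linear_combination h2
  rw [this, act_one]

lemma act_alphaDot_act_diracBeta (ν : Space) (v : Spinor) :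
    act (alphaDot ν) (act diracBeta v) = -act diracBeta (act (alphaDot ν) v) := by
  have h : ∀ j, act (diracAlpha j) (act diracBeta v) = -act diracBeta (act (diracAlpha j) v) :=
    fun j => by rw [← act_mul, diracAlpha_mul_diracBeta, act_neg, act_mul]
  simp only [act_alphaDot, h, map_sum, map_smul, smul_neg, Finset.sum_neg_distrib]

lemma act_diracBeta_act_diracBeta (v : Spinor) : act diracBeta (act diracBeta v) = v := by
  rw [← act_mul, diracBeta_mul_self, act_one]

/-! ### The chirality matrix -/

/-- A multiple of `α₁ α₂ α₃ β`, which anticommutes with all `αⱼ` and with `β`. -/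
def chirality : Matrix (Fin 4) (Fin 4) ℂ :=
  Matrix.reindex blockEquiv blockEquiv
    (Matrix.fromBlocks 0 (-1) (1 : Matrix (Fin 2) (Fin 2) ℂ) 0)

lemma diracAlpha_mul_chirality (j : Fin 3) :
    diracAlpha j * chirality = -(chirality * diracAlpha j) := by
  fin_cases j <;> ext a b <;> fin_cases a <;> fin_cases b <;>
    simp [diracAlpha, chirality, pauli, blockEquiv, finSumFinEquiv, Fin.addCases,
      Matrix.mul_apply, Fin.sum_univ_four]

lemma diracBeta_mul_chirality : diracBeta * chirality = -(chirality * diracBeta) := by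
  ext a b
  fin_cases a <;> fin_cases b <;>
    simp [diracBeta, chirality, blockEquiv, finSumFinEquiv, Fin.addCases,
      Matrix.mul_apply, Fin.sum_univ_four]

/-- Used only for injectivity, so that nonzero eigenfunctions stay nonzero. -/
lemma chirality_mul_self : chirality * chirality = -1 := by
  ext a b
  fin_cases a <;> fin_cases b <;>
    simp [chirality, blockEquiv, finSumFinEquiv, Fin.addCases, Matrix.mul_apply, Fin.sum_univ_four]

lemma diracAlpha_chirality (j : Fin 3) (v : Spinor) :
    act (diracAlpha j) (act chirality v) = -act chirality (act (diracAlpha j) v) := by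
  rw [← act_mul, diracAlpha_mul_chirality, act_neg, act_mul]

lemma diracBeta_chirality (v : Spinor) :
    act diracBeta (act chirality v) = -act chirality (act diracBeta v) := by
  rw [← act_mul, diracBeta_mul_chirality, act_neg, act_mul]

lemma alphaDot_chirality (ν : Space) (v : Spinor) :
    act (alphaDot ν) (act chirality v) = -act chirality (act (alphaDot ν) v) := by
  simp only [act_alphaDot, diracAlpha_chirality, map_sum, map_smul, smul_neg,
    Finset.sum_neg_distrib]

/-! ### Time reversal -/

/-- The time reversal `v ↦ -i diag(σ₂, σ₂) v̄`. -/
noncomputable def timeReversal : Spinor →L[ℝ] Spinor :=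
  LinearMap.toContinuousLinearMap
    { toFun := fun v => WithLp.toLp 2 ![-starRingEnd ℂ (v 1), starRingEnd ℂ (v 0),
        -starRingEnd ℂ (v 3), starRingEnd ℂ (v 2)]
      map_add' := fun u v => by
        ext i
        fin_cases i <;> simp [add_comm]
      map_smul' := fun a v => by
        ext i
        fin_cases i <;> simp }

lemma timeReversal_apply (v : Spinor) :
    timeReversal v = WithLp.toLp 2 ![-starRingEnd ℂ (v 1), starRingEnd ℂ (v 0),
        -starRingEnd ℂ (v 3), starRingEnd ℂ (v 2)] := rfl

lemma timeReversal_timeReversal (v : Spinor) : timeReversal (timeReversal v) = -v := by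
  ext i
  fin_cases i <;> simp [timeReversal_apply]

lemma timeReversal_smul (a : ℂ) (v : Spinor) :
    timeReversal (a • v) = starRingEnd ℂ a • timeReversal v := by
  ext i
  fin_cases i <;> simp [timeReversal_apply]

lemma act_apply (M : Matrix (Fin 4) (Fin 4) ℂ) (v : Spinor) (i : Fin 4) :
    act M v i = ∑ k, M i k * v k := rfl

/-- In each off-diagonal block this is `σ₂ σ̄ⱼ σ₂ = -σⱼ`. -/
lemma diracAlpha_timeReversal (j : Fin 3) (v : Spinor) :
    act (diracAlpha j) (timeReversal v) = -timeReversal (act (diracAlpha j) v) := by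
  ext i
  fin_cases j <;> fin_cases i <;>
    simp [act_apply, timeReversal_apply, diracAlpha, pauli, blockEquiv, finSumFinEquiv,
      Fin.addCases, Fin.sum_univ_four]

lemma diracBeta_timeReversal (v : Spinor) :
    act diracBeta (timeReversal v) = timeReversal (act diracBeta v) := by
  ext i
  fin_cases i <;>
    simp [act_apply, timeReversal_apply, diracBeta, blockEquiv, finSumFinEquiv,
      Fin.addCases, Fin.sum_univ_four]

lemma alphaDot_timeReversal (ν : Space) (v : Spinor) :
    act (alphaDot ν) (timeReversal v) = -timeReversal (act (alphaDot ν) v) := by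
  simp only [act_alphaDot, diracAlpha_timeReversal, map_sum, timeReversal_smul, smul_neg,
    Finset.sum_neg_distrib, Complex.conj_ofReal]

/-! ### Intertwining properties -/

lemma diracSymbol_neg (c m : ℝ) (w : Fin 3 → Spinor) (v : Spinor) :
    diracSymbol c m (fun j => -w j) (-v) = -diracSymbol c m w v := by
  simp only [diracSymbol, map_neg, Finset.sum_neg_distrib, smul_neg]
  abel

lemma diracSymbol_chirality (c m : ℝ) (w : Fin 3 → Spinor) (v : Spinor) :
    diracSymbol c m (fun j => act chirality (w j)) (act chirality v)
      = -act chirality (diracSymbol c m w v) := by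
  simp only [diracSymbol, diracAlpha_chirality, diracBeta_chirality, Finset.sum_neg_distrib,
    smul_neg, map_add, map_smul, map_sum]
  abel

/-- Two signs cancel: conjugation turns `-i c` into `i c`, and `αⱼ` picks up a minus sign. -/
lemma diracSymbol_timeReversal (c m : ℝ) (w : Fin 3 → Spinor) (v : Spinor) :
    diracSymbol c m (fun j => timeReversal (w j)) (timeReversal v)
      = timeReversal (diracSymbol c m w v) := by
  simp only [diracSymbol, diracAlpha_timeReversal, diracBeta_timeReversal,
    Finset.sum_neg_distrib, smul_neg, map_add, timeReversal_smul, map_sum, map_mul, map_neg,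
    Complex.conj_I, Complex.conj_ofReal, neg_neg, neg_mul, neg_smul]

/-- Apply minus the chirality matrix to the condition: the anticommuting terms `α·ν` and `τ β` keep
their sign, while the scalar term `η` changes it. -/
lemma isCoupled_chirality {c η τ : ℝ} {ν : Space} {p q : Spinor} (h : IsCoupled c η τ ν p q) :
    IsCoupled c (-η) τ ν (act chirality p) (act chirality q) := by
  rw [IsCoupled, act_shell] at h ⊢
  have h1 := congrArg (fun v => -act chirality v) h
  simp only [map_add, map_smul, map_zero, neg_zero] at h1
  rw [← map_sub, ← map_add, alphaDot_chirality, diracBeta_chirality, ← h1]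
  simp only [map_add, map_sub]
  push_cast
  module

/-- The conjugate of `i c` is compensated by the sign from `α·ν`; the real coefficients `η` and `τ`
are unaffected. -/
lemma isCoupled_timeReversal {c η τ : ℝ} {ν : Space} {p q : Spinor} (h : IsCoupled c η τ ν p q) :
    IsCoupled c η τ ν (timeReversal p) (timeReversal q) := by
  rw [IsCoupled, act_shell] at h ⊢
  have h1 := congrArg (fun v => timeReversal v) h
  simp only [map_zero] at h1
  rw [← map_sub timeReversal, ← map_add timeReversal, alphaDot_timeReversal,
    diracBeta_timeReversal, ← h1]
  simp only [map_add timeReversal, timeReversal_smul, map_mul, Complex.conj_I, Complex.conj_ofReal,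
    map_div₀, map_one, map_ofNat]
  module

/-- With `J = p - q`, `S = p + q` and `X = (α·ν) S`, applying `α·ν` to the condition gives `i c J +
½ (η - τ β) X = 0`. Multiplying by `η + τ β` gives `i c (η + τ β) J + ½ (η² - τ²) X = 0`, which is
the dual condition up to a scalar, as `S` and `J` are the jump and the sum of `p` and `-q`. -/
lemma IsCoupled.neg_right {c η τ : ℝ} (hc : c ≠ 0) (hητ : η ^ 2 - τ ^ 2 ≠ 0) {ν : Space}
    (hν : ‖ν‖ = 1) {p q : Spinor} (h : IsCoupled c η τ ν p q) :
    IsCoupled c (-4 * c ^ 2 * η / (η ^ 2 - τ ^ 2)) (-4 * c ^ 2 * τ / (η ^ 2 - τ ^ 2)) ν p (-q) := by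
  rw [IsCoupled, act_shell] at h ⊢
  rw [sub_neg_eq_add, ← sub_eq_add_neg]
  set J := p - q
  set S := p + q
  set X := act (alphaDot ν) S with hX
  have h1 := congrArg (fun v => act (alphaDot ν) v) h
  simp only [map_add, map_smul, map_zero, act_alphaDot_act_alphaDot hν,
    act_alphaDot_act_diracBeta, ← hX] at h1
  have h2 := congrArg (fun v => act diracBeta v) h1
  simp only [map_add, map_smul, map_zero, map_neg, act_diracBeta_act_diracBeta] at h2
  have hIc : Complex.I * (c : ℂ) ≠ 0 := mul_ne_zero Complex.I_ne_zero (by exact_mod_cast hc)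
  have hd : (η : ℂ) ^ 2 - (τ : ℂ) ^ 2 ≠ 0 := by exact_mod_cast hητ
  have hI : Complex.I ^ 2 = -1 := Complex.I_sq
  -- The extra factor `i c` makes the claim exactly `-2c² / (η² - τ²)` times `η h1 + τ h2`.
  have h3 : (Complex.I * (c : ℂ)) • ((Complex.I * (c : ℂ)) • X + (1 / 2 : ℂ) •
      (((-4 * c ^ 2 * η / (η ^ 2 - τ ^ 2) : ℝ) : ℂ) • J
        + ((-4 * c ^ 2 * τ / (η ^ 2 - τ ^ 2) : ℝ) : ℂ) • act diracBeta J)) = 0 := by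
    push_cast
    refine Eq.trans ?_ (congrArg₂ (fun u v => (-2 * c ^ 2 * η / (η ^ 2 - τ ^ 2) : ℂ) • u
      + (-2 * c ^ 2 * τ / (η ^ 2 - τ ^ 2) : ℂ) • v) h1 h2 |>.trans (by simp))
    match_scalars
    · field_simp
      linear_combination (c ^ 2 * (η ^ 2 - τ ^ 2) : ℂ) * hI
    all_goals
      field_simp
      try ring
  exact (smul_eq_zero.mp h3).resolve_left hIc

/-! ### Quaternionic structures -/

/-- A complex vector space with an antilinear map `J` such that `J² = -1` has even dimension. -/
theorem even_rank_of_antilinear {V : Type} [AddCommGroup V] [Module ℂ V]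
    (J : V →ₛₗ[starRingEnd ℂ] V) (hJ : ∀ v, J (J v) = -v) : Even (Module.rank ℂ V) := by
  by_cases hfin : FiniteDimensional ℂ V
  swap
  · have hinf : Cardinal.aleph0 ≤ Module.rank ℂ V := by
      rw [← not_lt, Module.rank_lt_aleph0_iff]
      exact hfin
    -- An infinite cardinal is even because it is its own double.
    exact ⟨_, (Cardinal.add_eq_self hinf).symm⟩
  · set b := Module.finBasis ℂ V
    set M : Matrix (Fin (Module.finrank ℂ V)) (Fin (Module.finrank ℂ V)) ℂ :=
      Matrix.of fun i k => b.repr (J (b k)) i with hM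
    have hJb : ∀ k, J (b k) = ∑ i, M i k • b i := fun k => (b.sum_repr (J (b k))).symm
    -- Antilinearity conjugates the coefficients when `J` is applied twice. Taking determinants
    -- gives `|det M|² = (-1)ⁿ`, which excludes odd `n`.
    have hMM : M * M.map (starRingEnd ℂ) = -1 := by
      ext i k
      have h1 : b.repr (J (J (b k))) i = (-1 : Matrix _ _ ℂ) i k := by
        rw [hJ, map_neg, b.repr_self, Matrix.neg_apply, Matrix.one_apply, Finsupp.neg_apply,
          Finsupp.single_apply]
        simp only [eq_comm]
      rw [← h1, hJb k, map_sum, map_sum, Finsupp.finsetSum_apply, Matrix.mul_apply]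
      refine Finset.sum_congr rfl fun l _ => ?_
      rw [map_smulₛₗ, map_smul, Finsupp.smul_apply, smul_eq_mul, Matrix.map_apply, mul_comm]
      rfl
    have hdet := congrArg Matrix.det hMM
    rw [Matrix.det_mul, Matrix.det_neg, Matrix.det_one, mul_one, Fintype.card_fin,
      ← RingHom.mapMatrix_apply, ← RingHom.map_det, Complex.mul_conj] at hdet
    rw [← Module.finrank_eq_rank]
    refine Even.natCast ?_
    by_contra hodd
    rw [(Nat.not_even_iff_odd.mp hodd).neg_one_pow] at hdet
    have h2 : Complex.normSq M.det = -1 := by exact_mod_cast hdet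
    linarith [Complex.normSq_nonneg M.det]

/-- Time reversal on the eigenspace of a real eigenvalue. -/
noncomputable def eigenspaceTimeReversal {c m η τ : ℝ} {Ω : BoundedC2Domain} {z : ℂ}
    (hz : starRingEnd ℂ z = z) :
    eigenspace (diracShell c m Ω η τ) z →ₛₗ[starRingEnd ℂ] eigenspace (diracShell c m Ω η τ) z :=
  have h : ∀ f : eigenspace (diracShell c m Ω η τ) z,
      IsEigenfunction c m η τ Ω.carrier z (timeReversal.compLp (f.1.1 : HilbertL2)) := fun f =>
    have hf : IsEigenfunction c m η τ Ω.carrier z (f.1.1 : HilbertL2) :=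
      isEigenfunction_iff.mpr ⟨f.1.2, sub_eq_zero.mp f.2⟩
    -- Antilinearity would send the eigenvalue `z` to `z̄`; this is where reality is needed.
    have hT : ∀ w v, diracSymbol c m w v = z • v →
        diracSymbol c m (fun j => timeReversal (w j)) (timeReversal v) = z • timeReversal v :=
      fun w v hwv => by rw [diracSymbol_timeReversal, hwv, timeReversal_smul, hz]
    hf.transport timeReversal timeReversal hT hT (fun _ _ _ _ => isCoupled_timeReversal)
      (ae_restrict_of_ae (timeReversal.coeFn_compLp _))
      (ae_restrict_of_ae (timeReversal.coeFn_compLp _))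
  { toFun := fun f => ⟨⟨timeReversal.compLp (f.1.1 : HilbertL2), (h f).1⟩, by
      obtain ⟨h1, h2⟩ := isEigenfunction_iff.mp (h f)
      exact sub_eq_zero.mpr h2⟩
    map_add' := fun f g => Subtype.ext (Subtype.ext
      (map_add (timeReversal.compLpₗ 2 (volume : Measure Space)) (f.1.1 : HilbertL2) g.1.1))
    map_smul' := fun a f => Subtype.ext (Subtype.ext (by
      refine Lp.ext ?_
      change timeReversal.compLp (a • (f.1.1 : HilbertL2))
        =ᵐ[volume] (starRingEnd ℂ a • timeReversal.compLp (f.1.1 : HilbertL2) : HilbertL2)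
      filter_upwards [timeReversal.coeFn_compLp (a • (f.1.1 : HilbertL2)),
        timeReversal.coeFn_compLp (f.1.1 : HilbertL2), Lp.coeFn_smul a (f.1.1 : HilbertL2),
        Lp.coeFn_smul (starRingEnd ℂ a) (timeReversal.compLp (f.1.1 : HilbertL2))]
        with x h1 h2 h3 h4
      rw [h1, h3, h4, Pi.smul_apply, Pi.smul_apply, h2, timeReversal_smul])) }

lemma eigenspaceTimeReversal_eigenspaceTimeReversal {c m η τ : ℝ} {Ω : BoundedC2Domain} {z : ℂ}
    (hz : starRingEnd ℂ z = z) (f : eigenspace (diracShell c m Ω η τ) z) :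
    eigenspaceTimeReversal hz (eigenspaceTimeReversal hz f) = -f := by
  refine Subtype.ext (Subtype.ext (Lp.ext ?_))
  change timeReversal.compLp (timeReversal.compLp (f.1.1 : HilbertL2))
    =ᵐ[volume] (-(f.1.1) : HilbertL2)
  filter_upwards [timeReversal.coeFn_compLp (timeReversal.compLp (f.1.1 : HilbertL2)),
    timeReversal.coeFn_compLp (f.1.1 : HilbertL2), Lp.coeFn_neg (f.1.1 : HilbertL2)] with x h1 h2 h3
  rw [h1, h2, h3, timeReversal_timeReversal, Pi.neg_apply]

/-! ### Symmetries of the point spectrum -/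

theorem conj_eq_of_mem_pointSpectrum {c m η τ : ℝ} (hc : c ≠ 0) {Ω : BoundedC2Domain} {z : ℂ}
    (h : z ∈ pointSpectrum (diracShell c m Ω η τ)) : starRingEnd ℂ z = z := by
  obtain ⟨F, hF0, hF⟩ := mem_pointSpectrum_iff.mp h
  refine Complex.conj_eq_iff_im.mpr (hF.im_eq_zero hc (Lp.memLp F) fun h0 => hF0 ?_)
  exact (Lp.eq_zero_iff_ae_eq_zero).mpr h0

theorem mem_pointSpectrum_neg_electrostatic {c m η τ : ℝ} {Ω : BoundedC2Domain} {z : ℂ}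
    (h : z ∈ pointSpectrum (diracShell c m Ω η τ)) :
    -z ∈ pointSpectrum (diracShell c m Ω (-η) τ) := by
  have hΓ : ∀ w v, diracSymbol c m w v = z • v →
      diracSymbol c m (fun j => (act chirality).restrictScalars ℝ (w j))
        ((act chirality).restrictScalars ℝ v) = -z • (act chirality).restrictScalars ℝ v :=
    fun w v hwv => by
      simp only [ContinuousLinearMap.coe_restrictScalars']
      rw [diracSymbol_chirality, hwv, map_smul, neg_smul]
  have h0 : ∀ v, (act chirality).restrictScalars ℝ v = 0 → v = 0 := fun v hv => by
    have h1 := congrArg (act chirality) hv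
    simp only [ContinuousLinearMap.coe_restrictScalars'] at h1
    rw [← act_mul, chirality_mul_self, act_neg, act_one, map_zero] at h1
    exact neg_eq_zero.mp h1
  exact mem_pointSpectrum_of_transport _ _ hΓ hΓ (fun _ _ _ _ => isCoupled_chirality) h0 h0 h

/-- The sign is reversed on the exterior side only, which exchanges the jump and the sum at the
boundary. -/
theorem mem_pointSpectrum_dual {c m η τ : ℝ} (hc : c ≠ 0) (hητ : η ^ 2 - τ ^ 2 ≠ 0)
    {Ω : BoundedC2Domain} {z : ℂ} (h : z ∈ pointSpectrum (diracShell c m Ω η τ)) :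
    z ∈ pointSpectrum (diracShell c m Ω (-4 * c ^ 2 * η / (η ^ 2 - τ ^ 2))
      (-4 * c ^ 2 * τ / (η ^ 2 - τ ^ 2))) := by
  refine mem_pointSpectrum_of_transport (ContinuousLinearMap.id ℝ Spinor)
    (-ContinuousLinearMap.id ℝ Spinor) (fun w v hwv => hwv) (fun w v hwv => ?_)
    (fun ν p q hν hpq => hpq.neg_right hc hητ hν) (fun v hv => hv)
    (fun v hv => neg_eq_zero.mp hv) h
  change diracSymbol c m (fun j => -w j) (-v) = z • -v
  rw [diracSymbol_neg, hwv, smul_neg]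

end DiracShell

theorem proposition4p2 (c m : ℝ) (hc : 0 < c) (hm : 0 < m) (Ω : DiracShell.BoundedC2Domain)
    (η τ : ℝ) (hητ : η ^ 2 - τ ^ 2 ≠ 4 * c ^ 2) :
    (η ^ 2 ≠ τ ^ 2 → ∀ z : ℂ,
      z ∈ DiracShell.pointSpectrum (DiracShell.diracShell c m Ω
          (-4 * c ^ 2 * η / (η ^ 2 - τ ^ 2)) (-4 * c ^ 2 * τ / (η ^ 2 - τ ^ 2))) ↔
        z ∈ DiracShell.pointSpectrum (DiracShell.diracShell c m Ω η τ)) ∧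
    (∀ z ∈ DiracShell.pointSpectrum (DiracShell.diracShell c m Ω η τ),
      Even (DiracShell.eigenvalueMultiplicity (DiracShell.diracShell c m Ω η τ) z)) ∧
    (∀ z : ℂ, z ∈ DiracShell.pointSpectrum (DiracShell.diracShell c m Ω η τ) ↔
      -z ∈ DiracShell.pointSpectrum (DiracShell.diracShell c m Ω (-η) τ)) := by
  refine ⟨fun hne z => ?_, fun z hz => ?_, fun z => ?_⟩
  · have hd : η ^ 2 - τ ^ 2 ≠ 0 := sub_ne_zero.mpr hne
    refine ⟨fun h => ?_, DiracShell.mem_pointSpectrum_dual hc.ne' hd⟩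
    set η' := -4 * c ^ 2 * η / (η ^ 2 - τ ^ 2) with hη'
    set τ' := -4 * c ^ 2 * τ / (η ^ 2 - τ ^ 2) with hτ'
    -- The dual parameters again have nonzero difference of squares, and dualising them returns `η`
    -- and `τ`, so the converse is the same implication applied a second time.
    have hd' : η' ^ 2 - τ' ^ 2 = 16 * c ^ 4 / (η ^ 2 - τ ^ 2) := by
      rw [hη', hτ', div_pow, div_pow, ← sub_div, div_eq_div_iff (pow_ne_zero 2 hd) hd]
      ring
    have hne' : η' ^ 2 - τ' ^ 2 ≠ 0 := by
      rw [hd']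
      have := hc.ne'
      positivity
    have h1 := DiracShell.mem_pointSpectrum_dual hc.ne' hne' h
    have hback : ∀ x : ℝ, -4 * c ^ 2 * (-4 * c ^ 2 * x / (η ^ 2 - τ ^ 2))
        / (16 * c ^ 4 / (η ^ 2 - τ ^ 2)) = x := fun x => by
      have := hc.ne'
      field_simp
      ring
    rwa [hd', hη', hτ', hback, hback] at h1
  · have hconj := DiracShell.conj_eq_of_mem_pointSpectrum hc.ne' hz
    exact DiracShell.even_rank_of_antilinear (DiracShell.eigenspaceTimeReversal hconj)
      (DiracShell.eigenspaceTimeReversal_eigenspaceTimeReversal hconj)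
  · refine ⟨DiracShell.mem_pointSpectrum_neg_electrostatic, fun h => ?_⟩
    simpa using DiracShell.mem_pointSpectrum_neg_electrostatic h
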